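/- Let $p$ be a prime, let $k$ be the field with $p$ elements, and let $G$ and $H$ be finite $p$-groups. Suppose that $G$ is generated by two elements and that the group algebras $kG$ and $kH$ are isomorphic as $k$-algebras. Then $$G/\gamma_2(G)^p\gamma_4(G)\;\cong\;H/\gamma_2(H)^p\gamma_4(H),$$ where $\gamma_1(X)=X$, $\gamma_{i+1}(X)=[\gamma_i(X),X]$ is the lower central series of a group $X$, and $\gamma_2(X)^p$ is the subgroup generated by the $p$-th powers of the elements of $\gamma_2(X)$. -/

import Mathlib

namespace BaginskiInvariant

/-- The `i`-th term `γ_i(G)` of the lower central series, with `γ_1(G) = G` and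
`γ_{i+1}(G) = [γ_i(G), G]`. Mathlib's series starts at index `0`. -/
def gam (i : ℕ) (G : Type*) [Group G] : Subgroup G :=
  (⊤ : Subgroup G).lowerCentralSeries (i - 1)

/-- `K ^ n`: the subgroup generated by the `n`-th powers of the elements of `K`. -/
def powSubgroup {G : Type*} [Group G] (K : Subgroup G) (n : ℕ) : Subgroup G :=
  Subgroup.closure ((fun x : G => x ^ n) '' (K : Set G))

instance gam_normal (i : ℕ) (G : Type*) [Group G] : (gam i G).Normal := by
  unfold gam; infer_instance

instance powSubgroup_normal {G : Type*} [Group G] (K : Subgroup G) [K.Normal] (n : ℕ) :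
    (powSubgroup K n).Normal := by
  refine ⟨fun x hx g => ?_⟩
  have hle : powSubgroup K n ≤ (powSubgroup K n).comap (MulAut.conj g).toMonoidHom := by
    refine (Subgroup.closure_le _).2 ?_
    rintro _ ⟨y, hy, rfl⟩
    refine Subgroup.subset_closure ⟨g * y * g⁻¹, Subgroup.Normal.conj_mem ‹K.Normal› y hy g, ?_⟩
    simp [conj_pow]
  simpa using hle hx

/-- `γ₂(G)^p γ₄(G)`, the product of two normal subgroups of `G`. -/
def kernelSubgroup (p : ℕ) (G : Type*) [Group G] : Subgroup G :=
  powSubgroup (gam 2 G) p ⊔ gam 4 G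

instance kernelSubgroup_normal (p : ℕ) (G : Type*) [Group G] : (kernelSubgroup p G).Normal := by
  unfold kernelSubgroup; infer_instance

end BaginskiInvariant

/-!
Let `D` be the augmentation ideal and `J` the commutator ideal of `k[G]`, where `k` has `p` elements
and `G` is a finite `p`-group, and let `A` be the quotient of `k[G]` by the *small* ideal
`D J + J D²`. A ring homomorphism between such group algebras preserves the augmentation, so `A`
depends only on the ring `k[G]`: it is a common model for `G` and `H`. The map `g ↦ g` embeds
`G / γ₂(G)^p γ₄(G)` in `A`, and the image of `γ₂(G)` is `1 + J`.

Let `a, b` generate `G` and `c, d` generate `H`, with `a, c` of order `p ^ m` modulo the commutator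
subgroups and with `b ^ p ^ n` and `d ^ p ^ n` in those, where `p ^ (m + n)` is the order of both
abelianizations. Calculating in `A` one can replace `a, b` by elements which agree with `c, d`
modulo `D²` and have the same `p ^ m`-th and `p ^ n`-th power, respectively, and the same additive
commutator as `c, d`. The subgroup of the product of `G / γ₂(G)^p γ₄(G)` and `H / γ₂(H)^p γ₄(H)`
generated by `(a, c)` and `(b, d)` then normalizes the group of pairs with a common image in
`1 + J`, which contains `⁅a, b⁆`, `a ^ p ^ m` and `b ^ p ^ n` paired with their counterparts. Hence
it has order at most `|J| p ^ (m + n) = |G / γ₂(G)^p γ₄(G)|`. As it projects onto both factors, it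
is the graph of an isomorphism.
-/

namespace BaginskiInvariant

open MonoidAlgebra
open scoped commutatorElement

/-! ### Small ideals -/

theorem geom_sum₂_eq_sub_pow_of_char {B : Type*} [CommRing B] (p : ℕ) [Fact p.Prime] [CharP B p]
    (a b : B) : ∑ i ∈ Finset.range p, a ^ i * b ^ (p - 1 - i) = (a - b) ^ (p - 1) := by
  -- Multiplied by `X 0 - X 1` this is the Frobenius identity, and `X 0 - X 1` may be cancelled in
  -- the polynomial ring.
  have universal : ∑ i ∈ Finset.range p, (MvPolynomial.X 0 : MvPolynomial (Fin 2) (ZMod p)) ^ i *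
      MvPolynomial.X 1 ^ (p - 1 - i) = (MvPolynomial.X 0 - MvPolynomial.X 1) ^ (p - 1) := by
    have hne : (MvPolynomial.X 0 - MvPolynomial.X 1 : MvPolynomial (Fin 2) (ZMod p)) ≠ 0 :=
      sub_ne_zero.2 fun h => absurd (MvPolynomial.X_injective h) (by decide)
    apply mul_right_cancel₀ hne
    rw [geom_sum₂_mul, ← pow_succ, Nat.sub_add_cancel (Fact.out : p.Prime).one_le, sub_pow_char]
  simpa using congrArg (MvPolynomial.eval₂Hom (ZMod.castHom (dvd_refl p) B) ![a, b]) universal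

theorem pow_sub_pow_eq_sum {A : Type*} [Ring A] (u y : A) (n : ℕ) :
    u ^ n - y ^ n = ∑ i ∈ Finset.range n, u ^ i * (u - y) * y ^ (n - 1 - i) := by
  have telescope : ∀ i ∈ Finset.range n, u ^ i * (u - y) * y ^ (n - 1 - i) =
      u ^ (i + 1) * y ^ (n - (i + 1)) - u ^ i * y ^ (n - i) := by
    intro i hi
    obtain ⟨j, rfl⟩ := Nat.exists_eq_add_of_lt (Finset.mem_range.1 hi)
    rw [show i + j + 1 - 1 - i = j by lia, show i + j + 1 - (i + 1) = j by lia,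
      show i + j + 1 - i = j + 1 by lia, pow_succ, pow_succ']
    noncomm_ring
  rw [Finset.sum_congr rfl telescope, Finset.sum_range_sub (fun i => u ^ i * y ^ (n - i))]
  simp

theorem two_le_prime_pow {p : ℕ} [Fact p.Prime] {k : ℕ} (hk : k ≠ 0) : 2 ≤ p ^ k :=
  (Fact.out : p.Prime).two_le.trans (Nat.le_self_pow hk p)

theorem add_sq_of_char_two {A : Type*} [Ring A] [CharP A 2] (y z : A) :
    (y + z) ^ 2 = y ^ 2 + z ^ 2 + (y * z - z * y) := by
  calc (y + z) ^ 2 = y ^ 2 + z ^ 2 + (y * z - z * y) + 2 * (z * y) := by noncomm_ring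
    _ = y ^ 2 + z ^ 2 + (y * z - z * y) := by rw [CharTwo.two_eq_zero (R := A), zero_mul, add_zero]

theorem pow_mem_sq_of_mem_ideal {A : Type*} [Ring A] (D : Ideal A) {x : A} (hx : x ∈ D)
    {k : ℕ} (hk : 2 ≤ k) : x ^ k ∈ D * D := by
  obtain ⟨k, rfl⟩ := Nat.exists_eq_add_of_le' hk
  rw [pow_add, sq]
  exact Ideal.mul_mem_left _ _ (Ideal.mul_mem_mul hx hx)

/-- Two ideals `M ≤ D²` of a ring such that the ring is commutative modulo `M` and the products
`D M` and `M D D` vanish. The example to keep in mind is the quotient of a group algebra `k[G]` by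
`D J + J D²`, where `D` is the augmentation ideal and `J` is the commutator ideal, whose image is
`M`. Both ideals are automatically two-sided. -/
structure IsSmall {A : Type*} [Ring A] (D M : Ideal A) : Prop where
  M_le : M ≤ D * D
  comm : ∀ x y : A, x * y - y * x ∈ M
  D_mul_M : ∀ {x m : A}, x ∈ D → m ∈ M → x * m = 0
  M_mul_D_mul_D : ∀ {m x y : A}, m ∈ M → x ∈ D → y ∈ D → m * x * y = 0

namespace IsSmall

variable {A : Type*} [Ring A] {D M : Ideal A}

theorem M_le_D (h : IsSmall D M) : M ≤ D := h.M_le.trans Ideal.mul_le_right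

theorem isTwoSided_M (h : IsSmall D M) : M.IsTwoSided :=
  ⟨fun {a} b ha => by
    simpa using M.add_mem (M.mul_mem_left b ha) (h.comm a b)⟩

theorem M_mul_M (h : IsSmall D M) {m n : A} (hm : m ∈ M) (hn : n ∈ M) : m * n = 0 :=
  h.D_mul_M (h.M_le_D hm) hn

theorem M_pow (h : IsSmall D M) {m : A} (hm : m ∈ M) {k : ℕ} (hk : 2 ≤ k) : m ^ k = 0 := by
  obtain ⟨k, rfl⟩ := Nat.exists_eq_add_of_le hk
  rw [pow_add, sq, h.M_mul_M hm hm, zero_mul]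

theorem M_mul_sq (h : IsSmall D M) {m z : A} (hm : m ∈ M) (hz : z ∈ D * D) : m * z = 0 := by
  refine Submodule.smul_induction_on hz (fun x hx y hy => ?_) fun x y hx hy => ?_
  · rw [smul_eq_mul, ← mul_assoc, h.M_mul_D_mul_D hm hx hy]
  · rw [mul_add, hx, hy, add_zero]

theorem M_mul_D_mul (h : IsSmall D M) {z v : A} (hz : z ∈ M * D) (hv : v ∈ D) : z * v = 0 := by
  refine Submodule.smul_induction_on hz (fun m hm x hx => h.M_mul_D_mul_D hm hx hv)
    fun x y hx hy => ?_
  rw [add_mul, hx, hy, add_zero]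

theorem mul_right_comm' (h : IsSmall D M) {x : A} (hx : x ∈ D) (a b : A) :
    x * (a * b) = x * (b * a) := by
  rw [← sub_eq_zero, ← mul_sub]
  exact h.D_mul_M hx (h.comm a b)

theorem mul_pow (h : IsSmall D M) {x : A} (hx : x ∈ D) (y : A) (k : ℕ) :
    (x * y) ^ k = x ^ k * y ^ k := by
  induction k with
  | zero => simp
  | succ k ih =>
    calc (x * y) ^ (k + 1) = x * (y * x ^ k) * y ^ k := by rw [pow_succ', ih]; noncomm_ring
      _ = x ^ (k + 1) * y ^ (k + 1) := by
        rw [h.mul_right_comm' hx, pow_succ', pow_succ']; noncomm_ring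

theorem mul_pow_eq_zero (h : IsSmall D M) {x y : A} {k : ℕ} (hk : 2 ≤ k) (hx : x ∈ D)
    (hxM : x ^ k ∈ M) (hy : y ∈ D) : (x * y) ^ k = 0 := by
  rw [h.mul_pow hx, h.M_mul_sq hxM (pow_mem_sq_of_mem_ideal D hy hk)]

theorem commute_self_mul (h : IsSmall D M) {x : A} (hx : x ∈ D) (y : A) : Commute x (x * y) := by
  rw [commute_iff_eq, mul_assoc, h.mul_right_comm' hx y x]

theorem one_add_mul_one_add (h : IsSmall D M) {x m : A} (hx : x ∈ D) (hm : m ∈ M) :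
    (1 + x) * (1 + m) = 1 + x + m := by
  rw [mul_one_add, add_mul, one_mul, h.D_mul_M hx hm, add_zero]

theorem comm_mem_M_mul_D (h : IsSmall D M) (y : A) {z : A} (hz : z ∈ D * D) :
    y * z - z * y ∈ M * D := by
  refine Submodule.smul_induction_on hz (fun a ha b hb => ?_) fun a b ha hb => ?_
  · have leibniz : y * (a * b) - a * b * y = (y * a - a * y) * b + a * (y * b - b * y) := by
      noncomm_ring
    rw [smul_eq_mul, leibniz, h.D_mul_M ha (h.comm _ _), add_zero]
    exact Ideal.mul_mem_mul (h.comm _ _) hb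
  · rw [show y * (a + b) - (a + b) * y = (y * a - a * y) + (y * b - b * y) by noncomm_ring]
    exact Ideal.add_mem _ ha hb

theorem mul_mul_comm_of_mem_sq (h : IsSmall D M) (u : A) {z v : A} (hz : z ∈ D * D)
    (hv : v ∈ D) : u * z * v = z * u * v := by
  rw [← sub_eq_zero, ← sub_mul]
  exact h.M_mul_D_mul (h.comm_mem_M_mul_D u hz) hv

theorem commute_of_mem_sq (h : IsSmall D M) {u v : A} (hu : u ∈ D * D) (hv : v ∈ D * D) :
    Commute u v := by
  refine Submodule.smul_induction_on hu (fun a ha b hb => ?_) fun _ _ => Commute.add_left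
  rw [smul_eq_mul, commute_iff_eq, mul_assoc, h.mul_right_comm' ha, ← mul_assoc,
    h.mul_mul_comm_of_mem_sq a hv hb, mul_assoc]

theorem commute_mul (h : IsSmall D M) (y : A) {a b : A} (ha : a ∈ D) (hb : b ∈ D * D) :
    Commute y (a * b) := by
  have leibniz : y * (a * b) - a * b * y = (y * a - a * y) * b + a * (y * b - b * y) := by
    noncomm_ring
  rw [commute_iff_eq, ← sub_eq_zero, leibniz, h.D_mul_M ha (h.comm _ _),
    h.M_mul_sq (h.comm _ _) hb, add_zero]

theorem commute_mul_of_mem_sq (h : IsSmall D M) (y : A) {a b : A} (ha : a ∈ D * D) (hb : b ∈ D) :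
    Commute y (a * b) := by
  have leibniz : y * (a * b) - a * b * y = (y * a - a * y) * b + a * (y * b - b * y) := by
    noncomm_ring
  rw [commute_iff_eq, ← sub_eq_zero, leibniz, h.M_mul_D_mul (h.comm_mem_M_mul_D y ha) hb,
    h.D_mul_M (Ideal.mul_le_right ha) (h.comm _ _), add_zero]

variable {p : ℕ} [Fact p.Prime] [CharP A p]

theorem add_pow_of_sq (h : IsSmall D M) {u v : A} (hu : u ∈ D * D) (hv : v ∈ D * D) (k : ℕ) :
    (u + v) ^ p ^ k = u ^ p ^ k + v ^ p ^ k :=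
  add_pow_char_pow_of_commute _ _ (h.commute_of_mem_sq hu hv)

theorem geom_sum₂_sub_mem (h : IsSmall D M) (a b : A) :
    ∑ i ∈ Finset.range p, a ^ i * b ^ (p - 1 - i) - (a - b) ^ (p - 1) ∈ M := by
  have := h.isTwoSided_M
  let : CommRing (A ⧸ M) :=
    { Ideal.Quotient.ring M with
      mul_comm := by
        rintro ⟨x⟩ ⟨y⟩
        exact Ideal.Quotient.eq.2 (h.comm x y) }
  rw [← Ideal.Quotient.eq]
  rcases subsingleton_or_nontrivial (A ⧸ M) with hs | hs
  · exact Subsingleton.elim _ _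
  have : CharP (A ⧸ M) p :=
    (CharP.charP_iff_prime_eq_zero Fact.out).2 <| by
      simpa only [map_natCast, map_zero] using
        congrArg (Ideal.Quotient.mk M) (CharP.cast_eq_zero A p)
  simpa only [map_sum, map_mul, map_pow, map_sub] using
    geom_sum₂_eq_sub_pow_of_char p (Ideal.Quotient.mk M a) (Ideal.Quotient.mk M b)

theorem add_pow_prime (h : IsSmall D M) (hp : 3 ≤ p) {y z : A} (hy : y ∈ D) (hz : z ∈ D * D) :
    (y + z) ^ p = y ^ p + z ^ p := by
  have hzD : z ∈ D := Ideal.mul_le_right hz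
  have pull_left : ∀ i ∈ Finset.range p, (y + z) ^ i * z * y ^ (p - 1 - i) =
      z * ((y + z) ^ i * y ^ (p - 1 - i)) := by
    intro i hi
    rw [Finset.mem_range] at hi
    rcases eq_or_ne i (p - 1) with rfl | hne
    · rw [Nat.sub_self, pow_zero, mul_one, mul_one]
      exact h.commute_of_mem_sq (pow_mem_sq_of_mem_ideal D (D.add_mem hy hzD) (by lia)) hz
    · rw [← mul_assoc]
      exact h.mul_mul_comm_of_mem_sq _ hz (D.pow_mem_of_mem hy _ (by lia))
  have geom_sum : z * ∑ i ∈ Finset.range p, (y + z) ^ i * y ^ (p - 1 - i) = z * z ^ (p - 1) := by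
    rw [← sub_eq_zero, ← mul_sub]
    simpa using h.D_mul_M hzD (h.geom_sum₂_sub_mem (p := p) (y + z) y)
  rw [← sub_eq_iff_eq_add', pow_sub_pow_eq_sum, add_sub_cancel_left,
    Finset.sum_congr rfl pull_left, ← Finset.mul_sum, geom_sum, mul_pow_sub_one (by lia)]

theorem add_pow_of_mem_sq (h : IsSmall D M) {k : ℕ} (hk : 3 ≤ p ^ k) {y z : A} (hy : y ∈ D)
    (hz : z ∈ D * D) : (y + z) ^ p ^ k = y ^ p ^ k + z ^ p ^ k := by
  have hp2 := (Fact.out : p.Prime).two_le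
  have hz2 : z ^ p ∈ D * D := pow_mem_sq_of_mem_ideal D (Ideal.mul_le_right hz) hp2
  have hy2 : y ^ p ∈ D * D := pow_mem_sq_of_mem_ideal D hy hp2
  obtain ⟨k, rfl⟩ : ∃ l, k = l + 1 := Nat.exists_eq_succ_of_ne_zero (by rintro rfl; simp at hk)
  rw [pow_succ', pow_mul, pow_mul, pow_mul]
  rcases hp2.eq_or_lt with rfl | hp
  · have hk0 : k ≠ 0 := by rintro rfl; norm_num at hk
    rw [add_sq_of_char_two, h.add_pow_of_sq (Ideal.add_mem _ hy2 hz2) (h.M_le (h.comm _ _)),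
      h.add_pow_of_sq hy2 hz2, h.M_pow (h.comm _ _) (two_le_prime_pow hk0), add_zero]
  · rw [h.add_pow_prime hp hy hz, h.add_pow_of_sq hy2 hz2]

theorem sq_pow_eq_zero (h : IsSmall D M) {k : ℕ} (hk : k ≠ 0) (hD : ∀ x ∈ D, x ^ p ^ k ∈ M)
    {z : A} (hz : z ∈ D * D) : z ^ p ^ k = 0 := by
  suffices z ∈ D * D ∧ z ^ p ^ k = 0 from this.2
  refine Submodule.smul_induction_on hz (fun x hx y hy => ⟨Ideal.mul_mem_mul hx hy, ?_⟩)
    fun x y hx hy => ⟨Ideal.add_mem _ hx.1 hy.1, ?_⟩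
  · exact h.mul_pow_eq_zero (two_le_prime_pow hk) hx (hD x hx) hy
  · rw [h.add_pow_of_sq hx.1 hy.1, hx.2, hy.2, add_zero]

end IsSmall

/-! ### The small ideal of a ring -/

section Ideals

/-- The two-sided ideal generated by the ring commutators. Multiplying the generators on the right
makes the left ideal they span two-sided. -/
def commIdeal (R : Type*) [Ring R] : Ideal R :=
  Ideal.span {r | ∃ y z s : R, r = (y * z - z * y) * s}

/-- `D J + J D²`, where `J` is the commutator ideal. This is the least two-sided ideal modulo which
`D` and `J` become a small pair in the sense of `IsSmall`, provided that `J ≤ D²`. -/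
def smallIdeal {R : Type*} [Ring R] (D : Ideal R) : Ideal R :=
  D * commIdeal R ⊔ commIdeal R * D * D

variable {R S : Type*} [Ring R] [Ring S]

theorem comm_mem_commIdeal (y z : R) : y * z - z * y ∈ commIdeal R :=
  Ideal.subset_span ⟨y, z, 1, by rw [mul_one]⟩

theorem commIdeal_le {I : Ideal R} [I.IsTwoSided] (hc : ∀ y z : R, y * z - z * y ∈ I) :
    commIdeal R ≤ I := by
  refine Ideal.span_le.2 ?_
  rintro _ ⟨y, z, s, rfl⟩
  exact Ideal.mul_mem_right _ _ (hc y z)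

instance commIdeal_isTwoSided : (commIdeal R).IsTwoSided := by
  refine ⟨fun {a} b ha => ?_⟩
  refine Submodule.span_induction (p := fun a _ => a * b ∈ commIdeal R) ?_ (by simp) ?_ ?_ ha
  · rintro _ ⟨y, z, s, rfl⟩
    exact Ideal.subset_span ⟨y, z, s * b, mul_assoc _ _ _⟩
  · intro x y _ _ hx hy
    exact add_mul x y b ▸ Ideal.add_mem _ hx hy
  · intro r x _ hx
    rw [smul_eq_mul, mul_assoc]
    exact Ideal.mul_mem_left _ _ hx

theorem commIdeal_le_comap (f : R →+* S) : commIdeal R ≤ (commIdeal S).comap f := by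
  refine commIdeal_le fun y z => ?_
  rw [Ideal.mem_comap, map_sub, map_mul, map_mul]
  exact comm_mem_commIdeal _ _

theorem exists_mem_commIdeal_map_eq {f : R →+* S} (hf : Function.Surjective f) {m : S}
    (hm : m ∈ commIdeal S) : ∃ r ∈ commIdeal R, f r = m := by
  suffices commIdeal S ≤ (commIdeal R).map f from (Ideal.mem_map_iff_of_surjective f hf).1 (this hm)
  refine Ideal.span_le.2 ?_
  rintro _ ⟨y, z, s, rfl⟩
  obtain ⟨⟨y, rfl⟩, ⟨z, rfl⟩, ⟨s, rfl⟩⟩ := hf y, hf z, hf s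
  have lift_mem : (y * z - z * y) * s ∈ commIdeal R := Ideal.subset_span ⟨y, z, s, rfl⟩
  rw [SetLike.mem_coe]
  simpa only [map_mul, map_sub] using Ideal.mem_map_of_mem f lift_mem

instance smallIdeal_isTwoSided (D : Ideal R) [D.IsTwoSided] : (smallIdeal D).IsTwoSided := by
  refine ⟨fun {a} b ha => ?_⟩
  obtain ⟨x, hx, y, hy, rfl⟩ := Submodule.mem_sup.1 ha
  rw [add_mul]
  exact Ideal.add_mem _ (Ideal.mem_sup_left (Ideal.mul_mem_right _ _ hx))
    (Ideal.mem_sup_right (Ideal.mul_mem_right _ _ hy))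

theorem smallIdeal_le_commIdeal (D : Ideal R) : smallIdeal D ≤ commIdeal R := by
  refine sup_le (Ideal.mul_le.2 fun x _ m hm => Ideal.mul_mem_left _ _ hm)
    (Ideal.mul_le.2 fun z hz t _ => Ideal.mul_mem_right _ _ ?_)
  exact Ideal.mul_le.2 (fun m hm x _ => Ideal.mul_mem_right _ _ hm) hz

theorem smallIdeal_le_iff {D I : Ideal R} : smallIdeal D ≤ I ↔
    (∀ x ∈ D, ∀ m ∈ commIdeal R, x * m ∈ I) ∧
      ∀ m ∈ commIdeal R, ∀ x ∈ D, ∀ y ∈ D, m * x * y ∈ I := by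
  refine ⟨fun h => ⟨fun x hx m hm => h (Ideal.mem_sup_left (Ideal.mul_mem_mul hx hm)),
    fun m hm x hx y hy => h (Ideal.mem_sup_right
      (Ideal.mul_mem_mul (Ideal.mul_mem_mul hm hx) hy))⟩, fun h => sup_le (Ideal.mul_le.2 h.1) ?_⟩
  refine Ideal.mul_le.2 fun z hz y hy => ?_
  refine Submodule.smul_induction_on hz (fun m hm x hx => h.2 m hm x hx y hy) fun a b ha hb => ?_
  exact add_mul a b y ▸ I.add_mem ha hb

theorem smallIdeal_le_comap (f : R →+* S) {D : Ideal R} {D' : Ideal S} (hD : D ≤ D'.comap f) :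
    smallIdeal D ≤ (smallIdeal D').comap f := by
  obtain ⟨left, right⟩ := smallIdeal_le_iff.1 (le_refl (smallIdeal D'))
  refine smallIdeal_le_iff.2 ⟨fun x hx m hm => ?_, fun m hm x hx y hy => ?_⟩
  · rw [Ideal.mem_comap, map_mul]
    exact left _ (hD hx) _ (commIdeal_le_comap f hm)
  · rw [Ideal.mem_comap, map_mul, map_mul]
    exact right _ (commIdeal_le_comap f hm) _ (hD hx) _ (hD hy)

theorem mul_sub_mul_eq_of_central {a b : R} (ha : ∀ x, Commute a x) (hb : ∀ x, Commute b x)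
    (x y : R) : x * y - y * x = (x - a) * (y - b) - (y - b) * (x - a) := by
  simp only [sub_mul, mul_sub, (ha y).eq, (hb x).eq, (ha b).eq]
  abel

theorem mul_sub_mul_eq_sub_one (x y : R) :
    x * y - y * x = (x - 1) * (y - 1) - (y - 1) * (x - 1) :=
  mul_sub_mul_eq_of_central Commute.one_left Commute.one_left x y

theorem sub_val_mem_ker {p : ℕ} [NeZero p] (ε : R →+* ZMod p) (x : R) :
    x - ((ε x).val : R) ∈ RingHom.ker ε := by
  rw [RingHom.mem_ker, map_sub, map_natCast, ZMod.natCast_zmod_val, sub_self]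

theorem commIdeal_le_ker_sq {p : ℕ} [NeZero p] (ε : R →+* ZMod p) :
    commIdeal R ≤ RingHom.ker ε * RingHom.ker ε := by
  refine commIdeal_le fun y z => ?_
  rw [mul_sub_mul_eq_of_central (Nat.cast_commute (ε y).val) (Nat.cast_commute (ε z).val)]
  exact Ideal.sub_mem _ (Ideal.mul_mem_mul (sub_val_mem_ker ε y) (sub_val_mem_ker ε z))
    (Ideal.mul_mem_mul (sub_val_mem_ker ε z) (sub_val_mem_ker ε y))

end Ideals

/-! ### Group algebras -/

section GroupAlgebra

variable (k : Type*) [CommRing k] {G : Type*} [Group G]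

variable (G) in
/-- The augmentation of the group algebra: the sum of the coefficients. -/
noncomputable def aug : MonoidAlgebra k G →ₐ[k] k :=
  MonoidAlgebra.lift k k G 1

/-- The homomorphism `k[G] → k[G/N]`. -/
noncomputable def mapQuotient (N : Subgroup G) [N.Normal] :
    MonoidAlgebra k G →ₐ[k] MonoidAlgebra k (G ⧸ N) :=
  MonoidAlgebra.mapDomainAlgHom k k (QuotientGroup.mk' N)

variable {k}

@[simp]
theorem aug_of (g : G) : aug k G (of k G g) = 1 := by
  simp [aug]

theorem of_sub_one_mem_ker_aug (g : G) : of k G g - 1 ∈ RingHom.ker (aug k G) := by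
  rw [RingHom.mem_ker, map_sub, aug_of, map_one, sub_self]

theorem ker_aug_le_span :
    (RingHom.ker (aug k G)).restrictScalars k ≤
      Submodule.span k (Set.range fun g : G => of k G g - 1) := by
  intro x hx
  have sub_aug_mem (x : MonoidAlgebra k G) : x - aug k G x • 1 ∈
      Submodule.span k (Set.range fun g : G => of k G g - 1) := by
    induction x using MonoidAlgebra.induction_on with
    | of g =>
      rw [aug_of, one_smul]
      exact Submodule.subset_span ⟨g, rfl⟩
    | add x y hx hy =>
      rw [map_add, add_smul, add_sub_add_comm]
      exact Submodule.add_mem _ hx hy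
    | smul r x hx =>
      rw [map_smul, smul_assoc, ← smul_sub]
      exact Submodule.smul_mem _ r hx
  simpa [RingHom.mem_ker.1 (show x ∈ RingHom.ker (aug k G) from hx)] using sub_aug_mem x

section Quotient

variable {N : Subgroup G} [N.Normal]

@[simp]
theorem mapQuotient_of (g : G) : mapQuotient k N (of k G g) = of k (G ⧸ N) g := by
  simp [mapQuotient]

variable (k N) in
theorem mapQuotient_surjective : Function.Surjective (mapQuotient k N) := by
  intro y
  induction y using MonoidAlgebra.induction_on with
  | of g =>
    obtain ⟨g, rfl⟩ := QuotientGroup.mk_surjective g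
    exact ⟨_, mapQuotient_of g⟩
  | add _ _ hx hy =>
    obtain ⟨⟨x, rfl⟩, ⟨y, rfl⟩⟩ := hx, hy
    exact ⟨x + y, map_add _ x y⟩
  | smul r _ hx =>
    obtain ⟨x, rfl⟩ := hx
    exact ⟨r • x, map_smul _ r x⟩

theorem of_sub_one_mem_ker_mapQuotient [Nontrivial k] (g : G) :
    of k G g - 1 ∈ RingHom.ker (mapQuotient k N) ↔ g ∈ N := by
  rw [RingHom.mem_ker, map_sub, map_one, mapQuotient_of, sub_eq_zero,
    ← map_one (of k (G ⧸ N)), MonoidAlgebra.of_injective.eq_iff, QuotientGroup.eq_one_iff]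

theorem ker_mapQuotient_le_span :
    (RingHom.ker (mapQuotient k N)).restrictScalars k ≤
      Submodule.span k {x | ∃ g : G, ∃ n ∈ N, x = of k G g * (of k G n - 1)} := by
  intro x hx
  -- Replacing every group element by the chosen representative of its coset changes `x` by an
  -- element of the span, and kills `x` because it factors through `mapQuotient`.
  let σ : MonoidAlgebra k (G ⧸ N) →ₗ[k] MonoidAlgebra k G :=
    (MonoidAlgebra.basis (G ⧸ N) k).constr k fun q => of k G q.out
  have σ_of (q : G ⧸ N) : σ (of k _ q) = of k G q.out := Module.Basis.constr_basis _ k _ q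
  have sub_σ_mem (x : MonoidAlgebra k G) : x - σ (mapQuotient k N x) ∈
      Submodule.span k {x | ∃ g : G, ∃ n ∈ N, x = of k G g * (of k G n - 1)} := by
    induction x using MonoidAlgebra.induction_on with
    | of g =>
      refine Submodule.subset_span ⟨(g : G ⧸ N).out, (g : G ⧸ N).out⁻¹ * g,
        QuotientGroup.eq.1 (QuotientGroup.out_eq' _), ?_⟩
      rw [mapQuotient_of, σ_of, mul_sub, mul_one, ← map_mul, mul_inv_cancel_left]
    | add x y hx hy =>
      rw [map_add, map_add, add_sub_add_comm]
      exact Submodule.add_mem _ hx hy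
    | smul r x hx =>
      rw [map_smul, map_smul, ← smul_sub]
      exact Submodule.smul_mem _ r hx
  simpa [RingHom.mem_ker.1 (show x ∈ RingHom.ker (mapQuotient k N) from hx)] using sub_σ_mem x

theorem commIdeal_le_ker_mapQuotient (hN : commutator G ≤ N) :
    commIdeal (MonoidAlgebra k G) ≤ RingHom.ker (mapQuotient k N) := by
  let : CommGroup (G ⧸ N) :=
    { QuotientGroup.Quotient.group N with
      mul_comm := (Subgroup.Normal.quotient_commutative_iff_commutator_le.2 hN).is_comm.comm }
  refine commIdeal_le fun y z => ?_
  rw [RingHom.mem_ker, map_sub, map_mul, map_mul, mul_comm, sub_self]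

end Quotient

theorem gam_two_eq_commutator : gam 2 G = commutator G := rfl

theorem of_sub_one_mem_commIdeal {n : G} (hn : n ∈ gam 2 G) :
    of k G n - 1 ∈ commIdeal (MonoidAlgebra k G) := by
  let f : G →* MonoidAlgebra k G ⧸ commIdeal (MonoidAlgebra k G) :=
    (Ideal.Quotient.mk (commIdeal (MonoidAlgebra k G))).toMonoidHom.comp (of k G)
  suffices gam 2 G ≤ f.ker from Ideal.Quotient.eq.1 (this hn)
  refine Subgroup.commutator_le.2 fun g _ h _ => ?_
  have comm : f (g * h) = f (h * g) := by
    rw [map_mul, map_mul]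
    exact Ideal.Quotient.eq.2 (comm_mem_commIdeal _ _)
  rw [MonoidHom.mem_ker, commutatorElement_def, mul_assoc (g * h), map_mul, comm, ← map_mul]
  simp [mul_assoc]

theorem ker_mapQuotient_gam_two :
    RingHom.ker (mapQuotient k (gam 2 G)) = commIdeal (MonoidAlgebra k G) := by
  refine le_antisymm (fun x hx => ?_) (commIdeal_le_ker_mapQuotient gam_two_eq_commutator.ge)
  have span_le : Submodule.span k
      {x | ∃ g : G, ∃ n ∈ gam 2 G, x = of k G g * (of k G n - 1)} ≤
        (commIdeal (MonoidAlgebra k G)).restrictScalars k := by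
    refine Submodule.span_le.2 ?_
    rintro _ ⟨g, n, hn, rfl⟩
    exact Ideal.mul_mem_left _ _ (of_sub_one_mem_commIdeal hn)
  exact span_le (ker_mapQuotient_le_span hx)

end GroupAlgebra

section Extension

variable {k : Type*} [CommRing k] {G : Type*} [Group G] {N : Subgroup G} [N.Normal]
  {W : Type*} [AddCommGroup W] [Module k W]

variable (k) in
omit [N.Normal] in
theorem exists_linearMap_mul_sub_one_eq (θ : Additive N →+ W) :
    ∃ l : MonoidAlgebra k G →ₗ[k] W,
      ∀ (g : G) (n : N), l (of k G g * (of k G n - 1)) = θ (Additive.ofMul n) := by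
  let coord (g : G) : N := ⟨(g : G ⧸ N).out⁻¹ * g, QuotientGroup.eq.1 (QuotientGroup.out_eq' _)⟩
  have coord_mul (g : G) (n : N) : coord (g * n) = coord g * n := by
    ext
    simp only [coord, QuotientGroup.mk_mul_of_mem g n.2, Subgroup.coe_mul, mul_assoc]
  refine ⟨(MonoidAlgebra.basis G k).constr k fun g => θ (Additive.ofMul (coord g)),
    fun g n => ?_⟩
  have constr_of (g : G) : (MonoidAlgebra.basis G k).constr k
      (fun g => θ (Additive.ofMul (coord g))) (of k G g) = θ (Additive.ofMul (coord g)) :=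
    Module.Basis.constr_basis _ k _ g
  rw [mul_sub, mul_one, ← map_mul, map_sub, constr_of, constr_of, coord_mul, ofMul_mul, map_add,
    add_sub_cancel_left]

variable {l : MonoidAlgebra k G →ₗ[k] W}
  (hl : ∀ (g : G) (n : N), l (of k G g * (of k G n - 1)) = l (of k G n - 1))

include hl

theorem map_mul_eq_aug_smul {r : MonoidAlgebra k G} (hr : r ∈ RingHom.ker (mapQuotient k N))
    (x : MonoidAlgebra k G) : l (x * r) = aug k G x • l r := by
  induction x using MonoidAlgebra.induction_on with
  | of g =>
    rw [aug_of, one_smul]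
    suffices (RingHom.ker (mapQuotient k N)).restrictScalars k ≤
        LinearMap.eqLocus (l ∘ₗ LinearMap.mulLeft k (of k G g)) l from this hr
    refine ker_mapQuotient_le_span.trans (Submodule.span_le.2 ?_)
    rintro _ ⟨h, n, hn, rfl⟩
    change l (of k G g * (of k G h * (of k G n - 1))) = l (of k G h * (of k G n - 1))
    rw [← mul_assoc, ← map_mul, hl _ ⟨n, hn⟩, hl _ ⟨n, hn⟩]
  | add x y hx hy => rw [add_mul, map_add, hx, hy, map_add, add_smul]
  | smul c x hx => rw [smul_mul_assoc, map_smul, hx, map_smul, smul_assoc]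

theorem map_mul_sub_one_mul_of (g h : G) (n : N) :
    l (of k G g * (of k G n - 1) * of k G h) =
      l (of k G (MulAut.conjNormal h⁻¹ n : N) - 1) := by
  rw [← hl (g * h)]
  congr 1
  simp only [mul_sub, sub_mul, mul_one, ← map_mul, MulAut.conjNormal_apply]
  congr 2
  group

variable (hconj : ∀ (n : N) (h h' : G),
  l (of k G (MulAut.conjNormal (h * h') n : N) - 1) + l (of k G n - 1) =
    l (of k G (MulAut.conjNormal h n : N) - 1) + l (of k G (MulAut.conjNormal h' n : N) - 1))

include hconj

theorem map_mul_mul_eq_zero {r s t : MonoidAlgebra k G} (hr : r ∈ RingHom.ker (mapQuotient k N))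
    (hs : s ∈ RingHom.ker (aug k G)) (ht : t ∈ RingHom.ker (aug k G)) : l (r * s * t) = 0 := by
  have generators (g : G) (n : N) (h h' : G) :
      l (of k G g * (of k G n - 1) * (of k G h - 1) * (of k G h' - 1)) = 0 := by
    set m := of k G g * (of k G n - 1) with hm
    have expand : m * (of k G h - 1) * (of k G h' - 1) =
        m * of k G (h * h') + m - (m * of k G h + m * of k G h') := by
      rw [map_mul]
      noncomm_ring
    rw [expand, map_sub, map_add, map_add, hm, map_mul_sub_one_mul_of hl,
      map_mul_sub_one_mul_of hl, map_mul_sub_one_mul_of hl, hl, mul_inv_rev, hconj, sub_eq_zero,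
      add_comm]
  have ht' (g : G) (n : N) (h : G) :
      l (of k G g * (of k G n - 1) * (of k G h - 1) * t) = 0 := by
    suffices (RingHom.ker (aug k G)).restrictScalars k ≤ LinearMap.ker
        (l ∘ₗ LinearMap.mulLeft k (of k G g * (of k G n - 1) * (of k G h - 1))) from this ht
    refine ker_aug_le_span.trans (Submodule.span_le.2 ?_)
    rintro _ ⟨h', rfl⟩
    exact generators g n h h'
  have hs' (g : G) (n : N) : l (of k G g * (of k G n - 1) * s * t) = 0 := by
    suffices (RingHom.ker (aug k G)).restrictScalars k ≤ LinearMap.ker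
        (l ∘ₗ LinearMap.mulRight k t ∘ₗ LinearMap.mulLeft k (of k G g * (of k G n - 1))) from
      this hs
    refine ker_aug_le_span.trans (Submodule.span_le.2 ?_)
    rintro _ ⟨h, rfl⟩
    exact ht' g n h
  suffices (RingHom.ker (mapQuotient k N)).restrictScalars k ≤ LinearMap.ker
      (l ∘ₗ LinearMap.mulRight k t ∘ₗ LinearMap.mulRight k s) from this hr
  refine ker_mapQuotient_le_span.trans (Submodule.span_le.2 ?_)
  rintro _ ⟨g, n, hn, rfl⟩
  exact hs' g ⟨n, hn⟩

theorem map_eq_zero_of_mem_smallIdeal (hN : commutator G ≤ N) {r : MonoidAlgebra k G}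
    (hr : r ∈ smallIdeal (RingHom.ker (aug k G))) : l r = 0 := by
  obtain ⟨x, hx, y, hy, rfl⟩ := Submodule.mem_sup.1 hr
  have hx0 : l x = 0 := by
    refine Submodule.smul_induction_on hx (fun a ha m hm => ?_) fun a b ha hb => ?_
    · rw [smul_eq_mul, map_mul_eq_aug_smul hl (commIdeal_le_ker_mapQuotient hN hm),
        RingHom.mem_ker.1 ha, zero_smul]
    · rw [map_add, ha, hb, add_zero]
  have hy0 : l y = 0 := by
    refine Submodule.smul_induction_on hy (fun z hz t ht => ?_) fun a b ha hb => ?_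
    · refine Submodule.smul_induction_on hz (fun m hm s hs => ?_) fun a b ha hb => ?_
      · exact map_mul_mul_eq_zero hl hconj (commIdeal_le_ker_mapQuotient hN hm) hs ht
      · rw [smul_eq_mul] at ha hb ⊢
        rw [add_mul, map_add, ha, hb, add_zero]
    · rw [map_add, ha, hb, add_zero]
  rw [map_add, hx0, hy0, add_zero]

end Extension

/-! ### Groups modulo `γ₂(G)^p γ₄(G)` -/

section LowerCentral

variable {G : Type*} [Group G]

theorem gam_antitone {i j : ℕ} (h : i ≤ j) : gam j G ≤ gam i G :=
  Subgroup.lowerCentralSeries_antitone _ (Nat.sub_le_sub_right h 1)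

theorem inv_mul_conj_mem_gam {i : ℕ} {n : G} (hn : n ∈ gam (i + 1) G) (h : G) :
    n⁻¹ * (h * n * h⁻¹) ∈ gam (i + 2) G := by
  have comm_mem : ⁅n⁻¹, h⁆ ∈ ⁅gam (i + 1) G, ⊤⁆ :=
    Subgroup.commutator_mem_commutator (inv_mem hn) (Subgroup.mem_top h)
  rw [commutatorElement_def, inv_inv, mul_assoc, mul_assoc, ← mul_assoc h] at comm_mem
  exact comm_mem

theorem commutator_gam_two_le : ⁅gam 2 G, gam 2 G⁆ ≤ gam 4 G := by
  have map_eq_bot : ⁅⁅gam 2 G, ⊤⁆, (⊤ : Subgroup G)⁆.map (QuotientGroup.mk' (gam 4 G)) = ⊥ :=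
    (QuotientGroup.map_mk'_self (gam 4 G) :)
  rw [Subgroup.map_commutator, Subgroup.map_commutator] at map_eq_bot
  have := Subgroup.commutator_commutator_eq_bot_of_rotate
    (by rwa [Subgroup.commutator_comm ((gam 2 G).map _)] at map_eq_bot) map_eq_bot
  rwa [← Subgroup.map_commutator, ← Subgroup.map_commutator, Subgroup.map_eq_bot_iff,
    QuotientGroup.ker_mk'] at this

theorem kernelSubgroup_le (p : ℕ) : kernelSubgroup p G ≤ gam 2 G := by
  refine sup_le ((Subgroup.closure_le _).2 ?_) (gam_antitone (by norm_num))
  rintro _ ⟨x, hx, rfl⟩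
  exact Subgroup.pow_mem _ hx p

instance : CommGroup (G ⧸ gam 2 G) :=
  { QuotientGroup.Quotient.group (gam 2 G) with
    mul_comm := (Subgroup.Normal.quotient_commutative_iff_commutator_le.2
      gam_two_eq_commutator.ge).is_comm.comm }

/-- `γ₂(G) / γ₂(G)^p γ₄(G)`. It is an elementary abelian group, and the commutator with a group
element depends linearly on that element. -/
abbrev GamTwoQuotient (p : ℕ) (G : Type*) [Group G] : Type _ :=
  gam 2 G ⧸ (kernelSubgroup p G).subgroupOf (gam 2 G)

variable {p : ℕ}

instance : CommGroup (GamTwoQuotient p G) :=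
  { QuotientGroup.Quotient.group ((kernelSubgroup p G).subgroupOf (gam 2 G)) with
    mul_comm := by
      refine (Subgroup.Normal.quotient_commutative_iff_commutator_le.2 ?_).is_comm.comm
      refine Subgroup.commutator_le.2 fun x _ y _ => Subgroup.mem_subgroupOf.2 ?_
      exact Subgroup.mem_sup_right
        (commutator_gam_two_le (Subgroup.commutator_mem_commutator x.2 y.2)) }

theorem gamTwoQuotient_pow_eq_one (x : GamTwoQuotient p G) : x ^ p = 1 := by
  obtain ⟨n, rfl⟩ := QuotientGroup.mk_surjective x
  refine (QuotientGroup.eq_one_iff (n ^ p)).2 (Subgroup.mem_subgroupOf.2 ?_)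
  exact Subgroup.mem_sup_left (Subgroup.subset_closure ⟨n, n.2, rfl⟩)

theorem gamTwoQuotient_mk_conj_mul (n : gam 2 G) (h h' : G) :
    ((MulAut.conjNormal (h * h') n : gam 2 G) : GamTwoQuotient p G) * (n : GamTwoQuotient p G) =
      ((MulAut.conjNormal h n : gam 2 G) : GamTwoQuotient p G) *
        ((MulAut.conjNormal h' n : gam 2 G) : GamTwoQuotient p G) := by
  have hc : (n : G)⁻¹ * (h' * n * h'⁻¹) ∈ gam 3 G := inv_mul_conj_mem_gam (i := 1) n.2 h'
  let c : gam 2 G := ⟨_, gam_antitone (by norm_num) hc⟩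
  have conj_c : ((MulAut.conjNormal h c : gam 2 G) : GamTwoQuotient p G) = c := by
    refine (QuotientGroup.eq.2 (Subgroup.mem_subgroupOf.2 (Subgroup.mem_sup_right ?_))).symm
    exact inv_mul_conj_mem_gam (i := 2) hc h
  have hn : MulAut.conjNormal h' n = n * c := by
    ext
    simp [c]
  rw [map_mul, MulAut.mul_apply, hn, map_mul, QuotientGroup.mk_mul, QuotientGroup.mk_mul, conj_c,
    mul_assoc, mul_comm (c : GamTwoQuotient p G)]

theorem map_eq_one_of_sub_one_mem_smallIdeal {N : Subgroup G} [N.Normal] (hN : commutator G ≤ N)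
    {Q : Type*} [CommGroup Q] (hQ : ∀ x : Q, x ^ p = 1) (f : N →* Q)
    (hf : ∀ (n : N) (h h' : G), f (MulAut.conjNormal (h * h') n) * f n =
      f (MulAut.conjNormal h n) * f (MulAut.conjNormal h' n)) {n : N}
    (hn : of (ZMod p) G n - 1 ∈ smallIdeal (RingHom.ker (aug (ZMod p) G))) : f n = 1 := by
  let := AddCommGroup.zmodModule (G := Additive Q) (n := p) hQ
  obtain ⟨l, hl⟩ := exists_linearMap_mul_sub_one_eq (ZMod p) (MonoidHom.toAdditive f)
  have l_sub_one (m : N) : l (of (ZMod p) G m - 1) = Additive.ofMul (f m) := by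
    rw [← one_mul (of (ZMod p) G m - 1), ← map_one (of (ZMod p) G)]
    exact hl 1 m
  have l_n := map_eq_zero_of_mem_smallIdeal (fun g m => (hl g m).trans (l_sub_one m).symm)
    (fun m h h' => by
      simp only [l_sub_one]
      exact congrArg Additive.ofMul (hf m h h')) hN hn
  rw [l_sub_one] at l_n
  exact Additive.ofMul.injective l_n

theorem mem_kernelSubgroup_of_sub_one_mem [Fact p.Prime] {g : G}
    (hg : of (ZMod p) G g - 1 ∈ smallIdeal (RingHom.ker (aug (ZMod p) G))) :
    g ∈ kernelSubgroup p G := by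
  have hg2 : g ∈ gam 2 G := by
    rw [← of_sub_one_mem_ker_mapQuotient (k := ZMod p), ker_mapQuotient_gam_two]
    exact smallIdeal_le_commIdeal _ hg
  have mk_eq_one := map_eq_one_of_sub_one_mem_smallIdeal gam_two_eq_commutator.ge
    gamTwoQuotient_pow_eq_one (QuotientGroup.mk' _) gamTwoQuotient_mk_conj_mul
    (n := ⟨g, hg2⟩) hg
  exact (QuotientGroup.eq_one_iff (⟨g, hg2⟩ : gam 2 G)).1 mk_eq_one

theorem mapQuotient_gam_two_pow [Fact p.Prime] {n : ℕ} (hn : ∀ g : G, g ^ p ^ n ∈ gam 2 G)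
    (r : MonoidAlgebra (ZMod p) G) :
    mapQuotient (ZMod p) (gam 2 G) r ^ p ^ n = algebraMap (ZMod p) _ (aug (ZMod p) G r) := by
  have : CharP (MonoidAlgebra (ZMod p) (G ⧸ gam 2 G)) p :=
    charP_of_injective_algebraMap (algebraMap (ZMod p) _).injective p
  induction r using MonoidAlgebra.induction_on with
  | of g =>
    rw [mapQuotient_of, ← map_pow, ← QuotientGroup.mk_pow, (QuotientGroup.eq_one_iff _).2 (hn g),
      map_one, aug_of, map_one]
  | add x y hx hy => rw [map_add, add_pow_char_pow, hx, hy, map_add, map_add]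
  | smul c x hx => rw [map_smul, smul_pow, hx, ZMod.pow_card_pow, map_smul, Algebra.smul_def,
      smul_eq_mul, map_mul]

end LowerCentral

/-! ### Group algebras modulo their small ideal -/

theorem map_mem_of_mem_span_zmod {p : ℕ} {V W : Type*} [AddCommGroup V] [Module (ZMod p) V]
    [AddCommGroup W] (f : V →+ W) {s : Set V} {T : AddSubgroup W} (hs : ∀ x ∈ s, f x ∈ T) {x : V}
    (hx : x ∈ Submodule.span (ZMod p) s) : f x ∈ T := by
  suffices Submodule.span (ZMod p) s ≤ AddSubgroup.toZModSubmodule p (T.comap f) from this hx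
  exact Submodule.span_le.2 hs

section Model

variable {p : ℕ} {G : Type*} [Group G] {A : Type*} [Ring A]

/-- The group homomorphism into the multiplicative monoid of `A` underlying a ring homomorphism
from the group algebra. -/
noncomputable def rho (π : MonoidAlgebra (ZMod p) G →+* A) : G →* A :=
  (π : MonoidAlgebra (ZMod p) G →* A).comp (of (ZMod p) G)

theorem rho_apply (π : MonoidAlgebra (ZMod p) G →+* A) (g : G) :
    rho π g = π (of (ZMod p) G g) := rfl

/-- `π` presents the augmented ring `A` as the quotient of the group algebra by its small ideal. -/
structure IsModel (ε : A →+* ZMod p) (π : MonoidAlgebra (ZMod p) G →+* A) : Prop where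
  surj : Function.Surjective π
  ker : RingHom.ker π = smallIdeal (RingHom.ker (aug (ZMod p) G))
  aug : ∀ r, ε (π r) = aug (ZMod p) G r

section Rho

variable (π : MonoidAlgebra (ZMod p) G →+* A)

theorem rho_mul_inv (g : G) : rho π g * rho π g⁻¹ = 1 := by
  rw [← map_mul, mul_inv_cancel, map_one]

theorem rho_inv_mul (g : G) : rho π g⁻¹ * rho π g = 1 := by
  rw [← map_mul, inv_mul_cancel, map_one]

theorem rho_mul_sub_one (g h : G) :
    rho π (g * h) - 1 = (rho π g - 1) + (rho π h - 1) + (rho π g - 1) * (rho π h - 1) := by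
  rw [map_mul]
  noncomm_ring

theorem rho_commutator (g h : G) :
    rho π ⁅g, h⁆ = 1 + (rho π g * rho π h - rho π h * rho π g) * rho π (g⁻¹ * h⁻¹) := by
  have cancel : h * g * (g⁻¹ * h⁻¹) = 1 := by group
  rw [sub_mul, ← map_mul, ← map_mul, ← map_mul, ← map_mul, commutatorElement_def, cancel, map_one,
    mul_assoc (g * h)]
  abel

end Rho

namespace IsModel

variable {ε : A →+* ZMod p} {π : MonoidAlgebra (ZMod p) G →+* A}

theorem map_mem_ker_iff (h : IsModel ε π) (r : MonoidAlgebra (ZMod p) G) :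
    π r ∈ RingHom.ker ε ↔ r ∈ RingHom.ker (BaginskiInvariant.aug (ZMod p) G) := by
  rw [RingHom.mem_ker, RingHom.mem_ker, h.aug]

theorem map_mem_commIdeal_iff (h : IsModel ε π) (r : MonoidAlgebra (ZMod p) G) :
    π r ∈ commIdeal A ↔ r ∈ commIdeal (MonoidAlgebra (ZMod p) G) := by
  refine ⟨fun hr => ?_, fun hr => commIdeal_le_comap π hr⟩
  obtain ⟨s, hs, hsr⟩ := exists_mem_commIdeal_map_eq h.surj hr
  have hker : r - s ∈ RingHom.ker π := by rw [RingHom.mem_ker, map_sub, hsr, sub_self]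
  rw [h.ker] at hker
  simpa only [sub_add_cancel] using Ideal.add_mem _ (smallIdeal_le_commIdeal _ hker) hs

theorem rho_sub_one_mem (h : IsModel ε π) (g : G) : rho π g - 1 ∈ RingHom.ker ε := by
  rw [rho_apply, ← map_one π, ← map_sub, h.map_mem_ker_iff]
  exact of_sub_one_mem_ker_aug g

theorem card_quotient_commIdeal [Finite G] (h : IsModel ε π) :
    Nat.card (A ⧸ commIdeal A) = p ^ Nat.card (G ⧸ gam 2 G) := by
  let f : MonoidAlgebra (ZMod p) G →+* A ⧸ commIdeal A := (Ideal.Quotient.mk _).comp π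
  have ker_f : RingHom.ker f = RingHom.ker (mapQuotient (ZMod p) (gam 2 G)).toRingHom := by
    ext r
    change f r = 0 ↔ r ∈ RingHom.ker (mapQuotient (ZMod p) (gam 2 G))
    rw [ker_mapQuotient_gam_two, ← h.map_mem_commIdeal_iff]
    exact Ideal.Quotient.eq_zero_iff_mem
  rw [← Nat.card_congr (RingHom.quotientKerEquivOfSurjective (f := f)
      (Ideal.Quotient.mk_surjective.comp h.surj)).toEquiv, ker_f,
    Nat.card_congr (RingHom.quotientKerEquivOfSurjective
      (f := (mapQuotient (ZMod p) (gam 2 G)).toRingHom) (mapQuotient_surjective _ _)).toEquiv,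
    Nat.card_congr MonoidAlgebra.coeffEquiv, Nat.card_congr Finsupp.equivFunOnFinite,
    Nat.card_fun, Nat.card_zmod]

theorem isSmall [NeZero p] (h : IsModel ε π) : IsSmall (RingHom.ker ε) (commIdeal A) := by
  obtain ⟨left, right⟩ := smallIdeal_le_iff.1 h.ker.ge
  refine ⟨commIdeal_le_ker_sq ε, comm_mem_commIdeal, fun {x m} hx hm => ?_,
    fun {m x y} hm hx hy => ?_⟩
  · obtain ⟨⟨x, rfl⟩, ⟨m, rfl⟩⟩ := h.surj x, h.surj m
    rw [← map_mul]
    exact left x ((h.map_mem_ker_iff x).1 hx) m ((h.map_mem_commIdeal_iff m).1 hm)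
  · obtain ⟨⟨m, rfl⟩, ⟨x, rfl⟩, ⟨y, rfl⟩⟩ := h.surj m, h.surj x, h.surj y
    rw [← map_mul, ← map_mul]
    exact right m ((h.map_mem_commIdeal_iff m).1 hm) x ((h.map_mem_ker_iff x).1 hx) y
      ((h.map_mem_ker_iff y).1 hy)

variable [Fact p.Prime]

theorem charP (_ : IsModel ε π) : CharP A p := by
  have : Nontrivial A := ε.domain_nontrivial
  refine (CharP.charP_iff_prime_eq_zero Fact.out).2 ?_
  rw [← map_natCast (π.comp (algebraMap (ZMod p) _)), CharP.cast_eq_zero, map_zero]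

theorem rho_sub_one_mem_commIdeal_iff (h : IsModel ε π) (g : G) :
    rho π g - 1 ∈ commIdeal A ↔ g ∈ gam 2 G := by
  rw [rho_apply, ← map_one π, ← map_sub, h.map_mem_commIdeal_iff, ← ker_mapQuotient_gam_two,
    of_sub_one_mem_ker_mapQuotient]

theorem mul_eq_self (h : IsModel ε π) (g : G) {m : A} (hm : m ∈ commIdeal A) :
    rho π g * m = m := by
  have := h.isSmall.D_mul_M (h.rho_sub_one_mem g) hm
  rwa [sub_mul, one_mul, sub_eq_zero] at this

theorem pow_mem_iff (h : IsModel ε π) (n : ℕ) :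
    (∀ g : G, g ^ p ^ n ∈ gam 2 G) ↔ ∀ x ∈ RingHom.ker ε, x ^ p ^ n ∈ commIdeal A := by
  have := h.charP
  refine ⟨fun hn x hx => ?_, fun hn g => ?_⟩
  · obtain ⟨r, rfl⟩ := h.surj x
    rw [← map_pow, h.map_mem_commIdeal_iff, ← ker_mapQuotient_gam_two, RingHom.mem_ker, map_pow,
      mapQuotient_gam_two_pow hn, RingHom.mem_ker.1 ((h.map_mem_ker_iff r).1 hx), map_zero]
  · have := hn _ (h.rho_sub_one_mem g)
    rw [sub_pow_char_pow_of_commute _ _ (Commute.one_right _), one_pow, ← map_pow] at this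
    exact (h.rho_sub_one_mem_commIdeal_iff _).1 this

theorem rho_commutator_of_mem_gam_two (h : IsModel ε π) {g : G} (hg : g ∈ gam 2 G) (k : G) :
    rho π ⁅g, k⁆ = 1 + (rho π g - 1) * (rho π k - 1) * rho π (g⁻¹ * k⁻¹) := by
  rw [rho_commutator, mul_sub_mul_eq_sub_one, h.isSmall.D_mul_M (h.rho_sub_one_mem k)
    ((h.rho_sub_one_mem_commIdeal_iff g).2 hg), sub_zero]

theorem rho_mul_of_mem_gam_three (h : IsModel ε π) {n : G} (hn : n ∈ gam 3 G) :
    ∀ v ∈ RingHom.ker ε, rho π n * v = v := by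
  refine Subgroup.closure_induction (p := fun n _ => ∀ v ∈ RingHom.ker ε, rho π n * v = v)
    ?_ (by simp) (fun x y _ _ hx hy v hv => ?_) (fun x _ hx v hv => ?_) hn
  · rintro _ ⟨g, hg, k, -, rfl⟩ v hv
    rw [h.rho_commutator_of_mem_gam_two hg, add_mul, mul_assoc _ _ v,
      h.isSmall.M_mul_D_mul_D ((h.rho_sub_one_mem_commIdeal_iff g).2 hg) (h.rho_sub_one_mem k)
        (Ideal.mul_mem_left _ _ hv), one_mul, add_zero]
  · rw [map_mul, mul_assoc, hy v hv, hx v hv]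
  · rw [← hx v hv, ← mul_assoc, rho_inv_mul, one_mul, hx v hv]

theorem rho_eq_one_of_mem_gam_four (h : IsModel ε π) {n : G} (hn : n ∈ gam 4 G) :
    rho π n = 1 := by
  suffices gam 4 G ≤ (rho π).ker from this hn
  refine (Subgroup.closure_le _).2 ?_
  rintro _ ⟨g, hg : g ∈ gam 3 G, k, -, rfl⟩
  change rho π ⁅g, k⁆ = 1
  rw [h.rho_commutator_of_mem_gam_two (gam_antitone (by norm_num) hg), sub_mul,
    h.rho_mul_of_mem_gam_three hg _ (h.rho_sub_one_mem k), one_mul, sub_self, zero_mul, add_zero]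

theorem rho_eq_one_iff (h : IsModel ε π) (g : G) :
    rho π g = 1 ↔ g ∈ kernelSubgroup p G := by
  refine ⟨fun hg => mem_kernelSubgroup_of_sub_one_mem (p := p) ?_, fun hg => ?_⟩
  · rw [← h.ker, RingHom.mem_ker, map_sub, ← rho_apply, hg, map_one, sub_self]
  have := h.charP
  suffices kernelSubgroup p G ≤ (rho π).ker from this hg
  refine sup_le ((Subgroup.closure_le _).2 ?_) fun n hn => h.rho_eq_one_of_mem_gam_four hn
  rintro _ ⟨n, hn, rfl⟩
  have sub_one_pow := h.isSmall.M_pow ((h.rho_sub_one_mem_commIdeal_iff n).2 hn)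
    (Fact.out : p.Prime).two_le
  rw [sub_pow_char_of_commute _ (Commute.one_right _), one_pow, sub_eq_zero] at sub_one_pow
  exact (map_pow _ n p).trans sub_one_pow

/-- The homomorphism `n ↦ n - 1` from `γ₂(G)` to the additive group of `A`. -/
noncomputable def gamTwoHom (h : IsModel ε π) : gam 2 G →* Multiplicative A where
  toFun n := Multiplicative.ofAdd (rho π n - 1)
  map_one' := by simp
  map_mul' m n := by
    rw [Subgroup.coe_mul, rho_mul_sub_one, h.isSmall.M_mul_M
      ((h.rho_sub_one_mem_commIdeal_iff m).2 m.2) ((h.rho_sub_one_mem_commIdeal_iff n).2 n.2),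
      add_zero, ofAdd_add]

theorem ker_gamTwoHom (h : IsModel ε π) :
    h.gamTwoHom.ker = (kernelSubgroup p G).subgroupOf (gam 2 G) := by
  ext n
  rw [MonoidHom.mem_ker, Subgroup.mem_subgroupOf, ← h.rho_eq_one_iff,
    ← sub_eq_zero (a := rho π n)]
  rfl

theorem ofAdd_mem_range_gamTwoHom_iff (h : IsModel ε π) {m : A} :
    Multiplicative.ofAdd m ∈ h.gamTwoHom.range ↔ m ∈ commIdeal A := by
  constructor
  · rintro ⟨n, hn⟩
    obtain rfl : rho π n - 1 = m := Multiplicative.ofAdd.injective hn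
    exact (h.rho_sub_one_mem_commIdeal_iff n).2 n.2
  intro hm
  obtain ⟨r, hr, rfl⟩ := exists_mem_commIdeal_map_eq h.surj hm
  rw [← ker_mapQuotient_gam_two] at hr
  refine map_mem_of_mem_span_zmod (T := h.gamTwoHom.range.toAddSubgroup') (π : _ →+ A) ?_
    (ker_mapQuotient_le_span hr)
  rintro _ ⟨g, n, hn, rfl⟩
  refine ⟨⟨n, hn⟩, congrArg Multiplicative.ofAdd ?_⟩
  change rho π n - 1 = π (of (ZMod p) G g * (of (ZMod p) G n - 1))
  rw [map_mul, map_sub, map_one, ← rho_apply, ← rho_apply,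
    h.mul_eq_self g ((h.rho_sub_one_mem_commIdeal_iff n).2 hn)]

theorem exists_rho_eq (h : IsModel ε π) {m : A} (hm : m ∈ commIdeal A) :
    ∃ n ∈ gam 2 G, rho π n = 1 + m := by
  obtain ⟨n, hn⟩ := h.ofAdd_mem_range_gamTwoHom_iff.2 hm
  exact ⟨n, n.2, sub_eq_iff_eq_add'.1 (Multiplicative.ofAdd.injective hn)⟩

theorem card_quotient_kernelSubgroup (h : IsModel ε π) :
    Nat.card (G ⧸ kernelSubgroup p G) =
      Nat.card (commIdeal A) * Nat.card (G ⧸ gam 2 G) := by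
  rw [← Subgroup.index_eq_card, ← Subgroup.index_eq_card,
    ← Subgroup.relIndex_mul_index (kernelSubgroup_le (G := G) p), Subgroup.relIndex,
    ← h.ker_gamTwoHom, Subgroup.index_ker]
  congr 1
  exact Nat.card_congr (Multiplicative.toAdd.subtypeEquiv
    fun m => h.ofAdd_mem_range_gamTwoHom_iff (m := m.toAdd))

end IsModel

end Model

/-! ### Generators of the group and of the augmentation ideal -/

/-- `X` and `Y` span the ideal `D` additively modulo `D²`. -/
structure Spans {A : Type*} [Ring A] (D : Ideal A) (X Y : A) : Prop where
  left_mem : X ∈ D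
  right_mem : Y ∈ D
  exists_sub_mem : ∀ x ∈ D, ∃ i j : ℤ, x - (i • X + j • Y) ∈ D * D

theorem Spans.congr {A : Type*} [Ring A] {D : Ideal A} {X Y X' Y' : A} (h : Spans D X Y)
    (hX : X - X' ∈ D * D) (hY : Y - Y' ∈ D * D) : Spans D X' Y' := by
  refine ⟨(D.sub_mem_iff_right h.left_mem).1 (Ideal.mul_le_right hX),
    (D.sub_mem_iff_right h.right_mem).1 (Ideal.mul_le_right hY), fun x hx => ?_⟩
  obtain ⟨i, j, hij⟩ := h.exists_sub_mem x hx
  refine ⟨i, j, ?_⟩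
  convert Ideal.add_mem _ hij (Ideal.add_mem _ (zsmul_mem hX i) (zsmul_mem hY j)) using 1
  module

theorem index_eq_of_isCoatom {p : ℕ} [Fact p.Prime] {G : Type*} [Group G] [Finite G]
    (hG : IsPGroup p G) {N : Subgroup G} (hN : IsCoatom N) : N.index = p := by
  obtain ⟨n, hn⟩ := IsPGroup.iff_card.1 (hG.to_subgroup N)
  obtain ⟨k, hk⟩ := hG.index N
  have k_ne_zero : k ≠ 0 := by
    rintro rfl
    exact hN.1 (Subgroup.index_eq_one.1 hk)
  obtain ⟨K, hK, hNK⟩ := Sylow.exists_subgroup_card_pow_succ (p := p) (n := n)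
    (by simpa only [← N.card_mul_index, hn, hk, pow_succ] using
      mul_dvd_mul_left _ (dvd_pow_self p k_ne_zero)) hn
  have N_ne_K : N ≠ K := by
    rintro rfl
    exact (Nat.pow_lt_pow_succ (Fact.out : p.Prime).one_lt).ne (hn.symm.trans hK)
  have card_G := N.card_mul_index
  rw [← Subgroup.card_top (G := G), ← hN.2 K (hNK.lt_of_ne N_ne_K), hK, hn, pow_succ] at card_G
  exact Nat.eq_of_mul_eq_mul_left (pow_pos (Fact.out : p.Prime).pos n) card_G

theorem exists_hom_zmod_of_ne_top {p : ℕ} [Fact p.Prime] {G : Type*} [Group G] [Finite G]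
    (hG : IsPGroup p G) {K : Subgroup G} (hK : K ≠ ⊤) :
    ∃ f : G →* Multiplicative (ZMod p), K ≤ f.ker ∧ f.ker ≠ ⊤ := by
  obtain ⟨N, hN, hKN⟩ := (eq_top_or_exists_le_coatom K).resolve_left hK
  have : Group.IsNilpotent G := hG.isNilpotent
  have : N.Normal :=
    Subgroup.NormalizerCondition.normal_of_coatom N Group.normalizerCondition_of_isNilpotent hN
  have card_quotient : Nat.card (G ⧸ N) = Nat.card (Multiplicative (ZMod p)) :=
    (index_eq_of_isCoatom hG hN).trans (Nat.card_zmod p).symm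
  have : IsCyclic (G ⧸ N) := isCyclic_of_prime_card (p := p) (card_quotient.trans (Nat.card_zmod p))
  let e : G ⧸ N ≃* Multiplicative (ZMod p) := mulEquivOfCyclicCardEq card_quotient
  have ker_eq : ((e : G ⧸ N →* Multiplicative (ZMod p)).comp (QuotientGroup.mk' N)).ker = N := by
    rw [MonoidHom.ker_mulEquiv_comp, QuotientGroup.ker_mk']
  exact ⟨_, hKN.trans_eq ker_eq.symm, ker_eq.trans_ne hN.1⟩

namespace IsModel

variable {p : ℕ} {G : Type*} [Group G] {A : Type*} [Ring A]
  {ε : A →+* ZMod p} {π : MonoidAlgebra (ZMod p) G →+* A}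

theorem exists_dualNumber_hom (h : IsModel ε π) (f : G →* Multiplicative (ZMod p)) :
    ∃ ψ : A →+* DualNumber (ZMod p), (∀ x, (ψ x).fst = ε x) ∧
      ∀ g, ψ (rho π g) = 1 + TrivSqZeroExt.inr (f g).toAdd := by
  let f' : G →* DualNumber (ZMod p) :=
    { toFun g := 1 + TrivSqZeroExt.inr (f g).toAdd
      map_one' := by simp
      map_mul' g k := by
        simp only [map_mul, toAdd_mul, TrivSqZeroExt.inr_add, mul_add, add_mul, mul_one, one_mul,
          TrivSqZeroExt.inr_mul_inr, add_zero, add_assoc] }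
  let F : MonoidAlgebra (ZMod p) G →ₐ[ZMod p] DualNumber (ZMod p) := MonoidAlgebra.lift _ _ _ f'
  have F_of (g : G) : F (of (ZMod p) G g) = f' g := MonoidAlgebra.lift_of f' g
  have ker_le : RingHom.ker π ≤ RingHom.ker F.toRingHom := by
    rw [h.ker]
    refine (smallIdeal_le_commIdeal _).trans (commIdeal_le fun y z => ?_)
    rw [RingHom.mem_ker, map_sub, map_mul, map_mul, mul_comm, sub_self]
  have fst_F : (TrivSqZeroExt.fstHom (ZMod p) (ZMod p) (ZMod p)).comp F =
      BaginskiInvariant.aug (ZMod p) G := by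
    refine MonoidAlgebra.algHom_ext (fun g => ?_) (Subsingleton.elim _ _)
    change (F (of (ZMod p) G g)).fst = BaginskiInvariant.aug (ZMod p) G (of (ZMod p) G g)
    rw [F_of, aug_of]
    simp [f']
  refine ⟨π.liftOfSurjective h.surj ⟨F.toRingHom, ker_le⟩, fun x => ?_, fun g => ?_⟩
  · obtain ⟨r, rfl⟩ := h.surj x
    rw [RingHom.liftOfSurjective_comp_apply, h.aug, ← fst_F]
    rfl
  · rw [rho_apply, RingHom.liftOfSurjective_comp_apply]
    exact F_of g

theorem closure_eq_top [Fact p.Prime] [Finite G] (h : IsModel ε π) (hG : IsPGroup p G) {a b : G}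
    (hs : Spans (RingHom.ker ε) (rho π a - 1) (rho π b - 1)) :
    Subgroup.closure {a, b} = ⊤ := by
  by_contra hab
  obtain ⟨f, hf, f_ne⟩ := exists_hom_zmod_of_ne_top hG hab
  rw [Subgroup.closure_le, Set.pair_subset_iff] at hf
  obtain ⟨ψ, fst_ψ, ψ_rho⟩ := h.exists_dualNumber_hom f
  have ψ_sub_one (g : G) : ψ (rho π g - 1) = TrivSqZeroExt.inr (f g).toAdd := by
    rw [map_sub, map_one, ψ_rho, add_sub_cancel_left]
  have ψ_sq {z : A} (hz : z ∈ RingHom.ker ε * RingHom.ker ε) : ψ z = 0 := by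
    suffices RingHom.ker ε * RingHom.ker ε ≤ RingHom.ker ψ from this hz
    refine Ideal.mul_le.2 fun x hx y hy => ?_
    rw [RingHom.mem_ker, map_mul]
    ext
    · rw [TrivSqZeroExt.fst_mul, fst_ψ, RingHom.mem_ker.1 hx, zero_mul, TrivSqZeroExt.fst_zero]
    · rw [DualNumber.snd_mul, fst_ψ, fst_ψ, RingHom.mem_ker.1 hx, RingHom.mem_ker.1 hy, zero_mul,
        mul_zero, add_zero, TrivSqZeroExt.snd_zero]
  refine f_ne (eq_top_iff.2 fun g _ => ?_)
  obtain ⟨i, j, hij⟩ := hs.exists_sub_mem _ (h.rho_sub_one_mem g)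
  have := ψ_sq hij
  rw [map_sub, map_add, map_zsmul, map_zsmul, ψ_sub_one, ψ_sub_one, ψ_sub_one,
    MonoidHom.mem_ker.1 hf.1, MonoidHom.mem_ker.1 hf.2, toAdd_one, TrivSqZeroExt.inr_zero,
    smul_zero, smul_zero, add_zero, sub_zero] at this
  exact TrivSqZeroExt.inr_injective this

/-- The homomorphism `g ↦ g - 1` from the group to the augmentation ideal modulo its square. -/
noncomputable def gradedHom (h : IsModel ε π) :
    G →* Multiplicative (A ⧸ RingHom.ker ε * RingHom.ker ε) where
  toFun g := Multiplicative.ofAdd (Submodule.Quotient.mk (rho π g - 1))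
  map_one' := by simp
  map_mul' g k := by
    rw [rho_mul_sub_one, Submodule.Quotient.mk_add, Submodule.Quotient.mk_add,
      (Submodule.Quotient.mk_eq_zero _).2
        (Ideal.mul_mem_mul (h.rho_sub_one_mem g) (h.rho_sub_one_mem k)), add_zero, ofAdd_add]

theorem exists_rho_sub_mem (h : IsModel ε π) {x : A} (hx : x ∈ RingHom.ker ε) :
    ∃ g : G, x - (rho π g - 1) ∈ RingHom.ker ε * RingHom.ker ε := by
  obtain ⟨r, rfl⟩ := h.surj x
  suffices Multiplicative.ofAdd (Submodule.Quotient.mk (π r)) ∈ h.gradedHom.range by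
    obtain ⟨g, hg⟩ := this
    exact ⟨g, (Submodule.Quotient.eq _).1 (Multiplicative.ofAdd.injective hg).symm⟩
  refine map_mem_of_mem_span_zmod (T := h.gradedHom.range.toAddSubgroup')
    ((Submodule.mkQ (RingHom.ker ε * RingHom.ker ε)).toAddMonoidHom.comp π.toAddMonoidHom) ?_
    (ker_aug_le_span ((h.map_mem_ker_iff r).1 hx))
  rintro _ ⟨g, rfl⟩
  refine ⟨g, congrArg Multiplicative.ofAdd ?_⟩
  change Submodule.Quotient.mk (rho π g - 1) = Submodule.Quotient.mk (π (of (ZMod p) G g - 1))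
  rw [map_sub, map_one, rho_apply]

theorem spans_of_closure (h : IsModel ε π) {a b : G} (hab : Subgroup.closure {a, b} = ⊤) :
    Spans (RingHom.ker ε) (rho π a - 1) (rho π b - 1) := by
  refine ⟨h.rho_sub_one_mem a, h.rho_sub_one_mem b, fun x hx => ?_⟩
  obtain ⟨g, hg⟩ := h.exists_rho_sub_mem hx
  have mem_closure : h.gradedHom g ∈ Subgroup.closure {h.gradedHom a, h.gradedHom b} := by
    rw [← Set.image_pair, ← MonoidHom.map_closure, hab]
    exact ⟨g, trivial, rfl⟩
  obtain ⟨i, j, hij⟩ := Subgroup.mem_closure_pair.1 mem_closure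
  refine ⟨i, j, ?_⟩
  rw [← Submodule.Quotient.eq] at hg ⊢
  rw [hg]
  exact (Multiplicative.ofAdd.injective hij).symm

theorem exists_spans (h : IsModel ε π) {X Y : A} (hs : Spans (RingHom.ker ε) X Y) :
    ∃ c d : G, Spans (RingHom.ker ε) (rho π c - 1) (rho π d - 1) := by
  obtain ⟨c, hc⟩ := h.exists_rho_sub_mem hs.left_mem
  obtain ⟨d, hd⟩ := h.exists_rho_sub_mem hs.right_mem
  exact ⟨c, d, hs.congr hc hd⟩

end IsModel

/-! ### Commutators of elements spanning the augmentation ideal -/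

section Commutators

theorem exists_nsmul_eq_zsmul_of_char {A : Type*} [Ring A] (p : ℕ) [NeZero p] [CharP A p]
    (i : ℤ) : ∃ k < p, ∀ v : A, i • v = k • v := by
  refine ⟨(i : ZMod p).val, ZMod.val_lt _, fun v => ?_⟩
  rw [zsmul_eq_mul, nsmul_eq_mul, ← map_natCast (ZMod.castHom dvd_rfl A), ZMod.natCast_zmod_val,
    map_intCast]

theorem one_add_pow_two_mul_of_char_two {A : Type*} [Ring A] [CharP A 2] (x : A) {k : ℕ}
    (hk : k < 2) : (1 + x) ^ (2 * k) = 1 + k • x ^ 2 := by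
  rw [pow_mul, add_sq_of_char_two, one_pow, one_mul, mul_one, sub_self, add_zero]
  interval_cases k
  · rw [pow_zero, zero_smul, add_zero]
  · rw [pow_one, one_smul]

variable {A : Type*} [Ring A]

namespace IsSmall

variable {D M : Ideal A}

theorem comm_sub_comm_mem (h : IsSmall D M) {x y x' y' : A}
    (hx : x - x' ∈ D * D) (hy : y - y' ∈ D * D) :
    x * y - y * x - (x' * y' - y' * x') ∈ M * D := by
  convert Ideal.sub_mem _ (h.comm_mem_M_mul_D x hy) (h.comm_mem_M_mul_D y' hx) using 1
  noncomm_ring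

theorem sq_comm (h : IsSmall D M) {x y y' : A} (hx : x ∈ D) (hy : y - y' ∈ D * D) :
    x ^ 2 * y - y * x ^ 2 = (x * y' - y' * x) * x := by
  have commute := (h.commute_of_mem_sq (pow_mem_sq_of_mem_ideal D hx le_rfl) hy).eq
  calc x ^ 2 * y - y * x ^ 2
      = x ^ 2 * (y - y') - (y - y') * x ^ 2 + x * (x * y' - y' * x) + (x * y' - y' * x) * x := by
        noncomm_ring
    _ = (x * y' - y' * x) * x := by rw [commute, sub_self, h.D_mul_M hx (h.comm x y'), zero_add,
        zero_add]

end IsSmall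

variable {p : ℕ} [NeZero p] {ε : A →+* ZMod p}

theorem exists_sub_zsmul_one_mem_ker (ε : A →+* ZMod p) (a : A) :
    ∃ c : ℤ, a - c • 1 ∈ RingHom.ker ε :=
  ⟨(ε a).val, by simpa only [natCast_zsmul, nsmul_one] using sub_val_mem_ker ε a⟩

section Spans

variable (h : IsSmall (RingHom.ker ε) (commIdeal A)) {X Y : A} (hs : Spans (RingHom.ker ε) X Y)

include h hs

theorem exists_comm_sub_zsmul_comm_mem (y z : A) : ∃ r : ℤ,
    y * z - z * y - r • (X * Y - Y * X) ∈ commIdeal A * RingHom.ker ε := by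
  obtain ⟨a, ha⟩ := exists_sub_zsmul_one_mem_ker ε y
  obtain ⟨b, hb⟩ := exists_sub_zsmul_one_mem_ker ε z
  obtain ⟨i, j, hij⟩ := hs.exists_sub_mem _ ha
  obtain ⟨i', j', hij'⟩ := hs.exists_sub_mem _ hb
  refine ⟨i * j' - j * i', ?_⟩
  convert h.comm_sub_comm_mem hij hij' using 1
  simp only [mul_add, add_mul, mul_sub, sub_mul, smul_mul_assoc, mul_smul_comm, one_mul, mul_one]
  module

theorem exists_sub_zsmul_comm_mem {m : A} (hm : m ∈ commIdeal A) :
    ∃ r : ℤ, m - r • (X * Y - Y * X) ∈ commIdeal A * RingHom.ker ε := by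
  refine Submodule.span_induction
    (p := fun m _ => ∃ r : ℤ, m - r • (X * Y - Y * X) ∈ commIdeal A * RingHom.ker ε)
    ?_ ⟨0, by simp⟩ ?_ ?_ hm
  · rintro _ ⟨y, z, s, rfl⟩
    obtain ⟨r, hr⟩ := exists_comm_sub_zsmul_comm_mem h hs y z
    obtain ⟨c, hc⟩ := exists_sub_zsmul_one_mem_ker ε s
    refine ⟨c * r, ?_⟩
    convert Ideal.add_mem _ (zsmul_mem hr c) (Ideal.mul_mem_mul (comm_mem_commIdeal y z) hc) using 1
    rw [mul_sub, mul_smul_comm, mul_one]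
    module
  · rintro x y _ _ ⟨r, hr⟩ ⟨r', hr'⟩
    refine ⟨r + r', ?_⟩
    convert Ideal.add_mem _ hr hr' using 1
    module
  · rintro a x hx ⟨r, hr⟩
    obtain ⟨c, hc⟩ := exists_sub_zsmul_one_mem_ker ε a
    have mul_eq := h.D_mul_M hc hx
    rw [sub_mul, smul_mul_assoc, one_mul, sub_eq_zero] at mul_eq
    refine ⟨c * r, ?_⟩
    rw [smul_eq_mul, mul_eq]
    convert zsmul_mem hr c using 1
    module

theorem exists_eq_of_mem_M_mul_D {z : A} (hz : z ∈ commIdeal A * RingHom.ker ε) :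
    ∃ i j : ℤ, z = i • ((X * Y - Y * X) * X) + j • ((X * Y - Y * X) * Y) := by
  refine Submodule.smul_induction_on hz (fun m hm v hv => ?_) ?_
  · obtain ⟨r, hr⟩ := exists_sub_zsmul_comm_mem h hs hm
    obtain ⟨i, j, hij⟩ := hs.exists_sub_mem _ hv
    have m_mul := h.M_mul_D_mul hr hv
    have comm_mul := h.M_mul_sq (comm_mem_commIdeal X Y) hij
    rw [sub_mul, smul_mul_assoc, sub_eq_zero] at m_mul
    rw [mul_sub, sub_eq_zero, mul_add, mul_smul_comm, mul_smul_comm] at comm_mul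
    exact ⟨r * i, r * j, by rw [smul_eq_mul, m_mul, comm_mul]; module⟩
  · rintro _ _ ⟨i, j, rfl⟩ ⟨i', j', rfl⟩
    exact ⟨i + i', j + j', by module⟩

theorem M_mul_D_eq_zero_of_mem_sq (hY : Y ∈ RingHom.ker ε * RingHom.ker ε) {z : A}
    (hz : z ∈ commIdeal A * RingHom.ker ε) : z = 0 := by
  obtain ⟨i, j, rfl⟩ := exists_eq_of_mem_M_mul_D h hs hz
  have comm_mem := h.comm_mem_M_mul_D X hY
  rw [h.M_mul_D_mul comm_mem hs.left_mem, h.M_mul_D_mul comm_mem hs.right_mem, smul_zero,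
    smul_zero, add_zero]

theorem M_mul_D_eq_zero_of_sq_mem (hsq : ∀ x ∈ RingHom.ker ε, x ^ 2 ∈ commIdeal A) {z : A}
    (hz : z ∈ commIdeal A * RingHom.ker ε) : z = 0 := by
  have hX := hsq X hs.left_mem
  have hY := hsq Y hs.right_mem
  obtain ⟨r, hr⟩ := exists_sub_zsmul_comm_mem h hs hX
  obtain ⟨r', hr'⟩ := exists_sub_zsmul_comm_mem h hs hY
  obtain ⟨i, j, rfl⟩ := exists_eq_of_mem_M_mul_D h hs hz
  have comm_mul_X : (X * Y - Y * X) * X = X ^ 2 * Y := by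
    have := h.sq_comm (y := Y) (y' := Y) hs.left_mem (by rw [sub_self]; exact Ideal.zero_mem _)
    rw [← this, h.D_mul_M hs.right_mem hX, sub_zero]
  have comm_mul_Y : (X * Y - Y * X) * Y = -(Y ^ 2 * X) := by
    have := h.sq_comm (y := X) (y' := X) hs.right_mem (by rw [sub_self]; exact Ideal.zero_mem _)
    rw [← neg_sub (Y * X), neg_mul, ← this, h.D_mul_M hs.left_mem hY, sub_zero]
  have cube_X := h.M_mul_D_mul hr hs.left_mem
  have sq_X_mul_Y := h.M_mul_D_mul hr hs.right_mem
  have sq_Y_mul_X := h.M_mul_D_mul hr' hs.left_mem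
  rw [sub_mul, smul_mul_assoc, ← pow_succ, pow_succ', h.D_mul_M hs.left_mem hX, zero_sub,
    neg_eq_zero] at cube_X
  rw [sub_mul, smul_mul_assoc, ← comm_mul_X, sub_eq_zero] at sq_X_mul_Y
  rw [sub_mul, smul_mul_assoc, sub_eq_zero] at sq_Y_mul_X
  rw [sq_Y_mul_X] at comm_mul_Y
  have comm_mul_X_eq_zero : (X * Y - Y * X) * X = 0 := by
    rw [sq_X_mul_Y, comm_mul_Y, smul_neg, smul_comm, cube_X, smul_zero, neg_zero]
  rw [comm_mul_Y, comm_mul_X_eq_zero, smul_zero, smul_zero, neg_zero, smul_zero, add_zero]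

theorem exists_comm_add_eq {z : A} (hz : z ∈ commIdeal A * RingHom.ker ε) :
    ∃ m ∈ commIdeal A, ∃ n ∈ commIdeal A,
      (X + m) * (Y + n) - (Y + n) * (X + m) = X * Y - Y * X + z := by
  obtain ⟨i, j, rfl⟩ := exists_eq_of_mem_M_mul_D h hs hz
  have comm_mem := comm_mem_commIdeal X Y
  refine ⟨j • (X * Y - Y * X), zsmul_mem comm_mem j, -i • (X * Y - Y * X), zsmul_mem comm_mem _, ?_⟩
  have X_mul := h.D_mul_M hs.left_mem comm_mem
  have Y_mul := h.D_mul_M hs.right_mem comm_mem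
  have comm_mul := h.M_mul_M comm_mem comm_mem
  have expand (w : A) (hXw : X * w = 0) (hYw : Y * w = 0) (hww : w * w = 0) :
      (X + j • w) * (Y + -i • w) - (Y + -i • w) * (X + j • w) =
        X * Y - Y * X + (i • (w * X) + j • (w * Y)) := by
    simp only [add_mul, mul_add, smul_mul_assoc, mul_smul_comm, hXw, hYw, hww, smul_zero]
    module
  exact expand _ X_mul Y_mul comm_mul

/-- The correction is the multiplication of the unit `1 + x` by `(1 + X) ^ (2 i) (1 + m)`: the
commutator of `X²` with `y` is `[X, Y] X`, and the commutators of `m` with `y` span the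
multiples of `[X, Y] Y`. -/
theorem exists_comm_add_eq_of_char_two [CharP A 2] {x y : A} (hx : x ∈ RingHom.ker ε)
    (hy : y - Y ∈ RingHom.ker ε * RingHom.ker ε) {z : A}
    (hz : z ∈ commIdeal A * RingHom.ker ε) :
    ∃ i : ℕ, ∃ m ∈ commIdeal A, ∃ x', 1 + x' = (1 + x) * (1 + X) ^ (2 * i) * (1 + m) ∧
      x - x' ∈ RingHom.ker ε * RingHom.ker ε ∧ x' * y - y * x' = x * y - y * x + z := by
  obtain ⟨i, j, rfl⟩ := exists_eq_of_mem_M_mul_D h hs hz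
  obtain ⟨k, hk, zsmul_eq⟩ := exists_nsmul_eq_zsmul_of_char (A := A) 2 i
  have comm_mem := comm_mem_commIdeal X Y
  have m_mem : j • (X * Y - Y * X) ∈ commIdeal A := zsmul_mem comm_mem j
  have q_mem : k • X ^ 2 ∈ RingHom.ker ε * RingHom.ker ε :=
    nsmul_mem (pow_mem_sq_of_mem_ideal _ hs.left_mem le_rfl) k
  have xq_mem : x * (k • X ^ 2) ∈ RingHom.ker ε * RingHom.ker ε := Ideal.mul_mem_left _ _ q_mem
  have q_comm : k • X ^ 2 * y - y * (k • X ^ 2) = i • ((X * Y - Y * X) * X) := by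
    rw [smul_mul_assoc, mul_smul_comm, ← smul_sub, h.sq_comm hs.left_mem hy, zsmul_eq]
  have m_comm : j • (X * Y - Y * X) * y - y * (j • (X * Y - Y * X)) =
      j • ((X * Y - Y * X) * Y) := by
    have := h.M_mul_sq m_mem hy
    have y_mem := (Submodule.sub_mem_iff_left _ hs.right_mem).1 (Ideal.mul_le_right hy)
    rw [h.D_mul_M y_mem m_mem, sub_zero, ← smul_mul_assoc]
    rwa [mul_sub, sub_eq_zero] at this
  have xq_comm : x * (k • X ^ 2) * y - y * (x * (k • X ^ 2)) = 0 :=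
    sub_eq_zero.2 (h.commute_mul y hx q_mem).eq.symm
  generalize j • (X * Y - Y * X) = m at *
  refine ⟨k, m, m_mem, x + k • X ^ 2 + x * (k • X ^ 2) + m, ?_, ?_, ?_⟩
  · rw [one_add_pow_two_mul_of_char_two X hk]
    generalize k • X ^ 2 = q at *
    have mul_eq_zero := h.D_mul_M (Ideal.add_mem _ (Ideal.add_mem _ hx (Ideal.mul_le_right q_mem))
      (Ideal.mul_le_right xq_mem)) m_mem
    have expand : (1 + x) * (1 + q) * (1 + m) =
        1 + (x + q + x * q + m) + (x + q + x * q) * m := by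
      noncomm_ring
    rw [expand, mul_eq_zero, add_zero]
  · rw [← neg_mem_iff]
    convert Ideal.add_mem _ (Ideal.add_mem _ q_mem xq_mem) (h.M_le m_mem) using 1
    abel
  · rw [← q_comm, ← m_comm, ← add_zero (_ - _ + _), ← xq_comm]
    noncomm_ring

end Spans

end Commutators

/-! ### Elements with small Frobenius power -/

theorem closure_pair_mk_eq_top {G : Type*} [Group G] (N : Subgroup G) [N.Normal] {a b : G}
    (hab : Subgroup.closure {a, b} = ⊤) : Subgroup.closure {(a : G ⧸ N), (b : G ⧸ N)} = ⊤ := by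
  have := congrArg (Subgroup.map (QuotientGroup.mk' N)) hab
  rwa [MonoidHom.map_closure, Set.image_pair, Subgroup.map_top_of_surjective _
    (QuotientGroup.mk'_surjective N)] at this

section Frobenius

variable {p : ℕ} [Fact p.Prime] {Q : Type*} [CommGroup Q]

theorem pow_prime_pow_eq_mapDomain (n : ℕ) (r : MonoidAlgebra (ZMod p) Q) :
    r ^ p ^ n = mapDomainAlgHom (ZMod p) (ZMod p) (powMonoidHom (p ^ n) : Q →* Q) r := by
  have : CharP (MonoidAlgebra (ZMod p) Q) p :=
    charP_of_injective_algebraMap (algebraMap (ZMod p) _).injective p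
  induction r using MonoidAlgebra.induction_on with
  | of g => rw [← map_pow]; simp
  | add x y hx hy => rw [add_pow_char_pow, hx, hy, map_add]
  | smul c x hx => rw [smul_pow, hx, ZMod.pow_card_pow, map_smul]

theorem mem_ker_mapQuotient_of_mapDomain_eq_zero {k G H : Type*} [CommRing k] [Group G] [Group H]
    (φ : G →* H) {r : MonoidAlgebra k G} (hr : mapDomainAlgHom k k φ r = 0) :
    r ∈ RingHom.ker (mapQuotient k φ.ker) := by
  have factor : (mapDomainAlgHom k k (QuotientGroup.kerLift φ)).comp (mapQuotient k φ.ker) =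
      mapDomainAlgHom k k φ := by
    ext g
    simp [mapQuotient]
  rw [← factor, AlgHom.comp_apply] at hr
  exact (map_eq_zero_iff (mapDomainAlgHom k k (QuotientGroup.kerLift φ))
    (mapDomain_injective (QuotientGroup.kerLift_injective φ))).1 hr

theorem of_sub_one_mem_of_mem_closure {k : Type*} [CommRing k] {I : Ideal (MonoidAlgebra k Q)}
    {S : Set Q} (hS : ∀ g ∈ S, of k Q g - 1 ∈ I) {g : Q} (hg : g ∈ Subgroup.closure S) :
    of k Q g - 1 ∈ I := by
  let f : Q →* MonoidAlgebra k Q ⧸ I := (Ideal.Quotient.mk I).toMonoidHom.comp (of k Q)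
  suffices Subgroup.closure S ≤ f.ker from Ideal.Quotient.eq.1 (this hg)
  exact (Subgroup.closure_le _).2 fun g hg => Ideal.Quotient.eq.2 (hS g hg)

theorem ker_powMonoidHom_le_closure {a b : Q} (hab : Subgroup.closure {a, b} = ⊤) {d N : ℕ}
    (hN : N ≠ 0) (ha : orderOf a = d * N) (hb : b ^ N = 1) :
    (powMonoidHom N : Q →* Q).ker ≤ Subgroup.closure {a ^ d, b} := by
  intro g (hg : g ^ N = 1)
  obtain ⟨i, j, rfl⟩ := Subgroup.mem_closure_pair.1 (hab ▸ Subgroup.mem_top g)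
  have dvd : (orderOf a : ℤ) ∣ i * N := by
    rw [orderOf_dvd_iff_zpow_eq_one, zpow_mul, zpow_natCast]
    rwa [mul_pow, ← zpow_natCast (b ^ j), zpow_comm, zpow_natCast, hb, one_zpow, mul_one] at hg
  obtain ⟨c, rfl⟩ : (d : ℤ) ∣ i :=
    Int.dvd_of_mul_dvd_mul_right (Nat.cast_ne_zero.2 hN) (by exact_mod_cast ha ▸ dvd)
  exact Subgroup.mem_closure_pair.2 ⟨c, j, by rw [zpow_mul, zpow_natCast]⟩

theorem exists_eq_of_pow_prime_pow_eq_zero {a b : Q} (hab : Subgroup.closure {a, b} = ⊤)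
    {d n : ℕ} (ha : orderOf a = d * p ^ n) (hb : b ^ p ^ n = 1) {r : MonoidAlgebra (ZMod p) Q}
    (hr : r ^ p ^ n = 0) :
    ∃ r₁ r₂, (of (ZMod p) Q (a ^ d) - 1) * r₁ + (of (ZMod p) Q b - 1) * r₂ = r := by
  let I : Ideal (MonoidAlgebra (ZMod p) Q) :=
    Ideal.span {of (ZMod p) Q (a ^ d) - 1, of (ZMod p) Q b - 1}
  have closure_mem : ∀ g ∈ Subgroup.closure {a ^ d, b}, of (ZMod p) Q g - 1 ∈ I := by
    refine fun g => of_sub_one_mem_of_mem_closure ?_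
    rintro _ (rfl | rfl)
    exacts [Ideal.subset_span (Or.inl rfl), Ideal.subset_span (Or.inr rfl)]
  rw [pow_prime_pow_eq_mapDomain] at hr
  have r_mem : r ∈ I := by
    refine Submodule.span_le (p := I.restrictScalars (ZMod p)).2 ?_
      (ker_mapQuotient_le_span (mem_ker_mapQuotient_of_mapDomain_eq_zero _ hr))
    rintro _ ⟨g, t, ht, rfl⟩
    exact I.mul_mem_left _ (closure_mem t (ker_powMonoidHom_le_closure hab
      (pow_ne_zero n (Fact.out : p.Prime).ne_zero) ha hb ht))
  obtain ⟨r₁, r₂, rfl⟩ := Ideal.mem_span_pair.1 r_mem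
  exact ⟨r₁, r₂, by rw [mul_comm r₁, mul_comm r₂]⟩

end Frobenius

theorem exists_one_add_pow_eq {A K : Type*} [Ring A] [Ring K] {ε : A →+* K} {x : A}
    (hx : x ∈ RingHom.ker ε) (j : ℕ) :
    ∃ s, (1 + x) ^ j = 1 + x * s ∧ ε s = j := by
  refine ⟨∑ i ∈ Finset.range j, (1 + x) ^ i, ?_, ?_⟩
  · simpa [sub_eq_iff_eq_add'] using ((Commute.one_right (1 + x)).mul_geom_sum₂ j).symm
  · simp [RingHom.mem_ker.1 hx]

section Model

variable {p : ℕ} [Fact p.Prime] {G A : Type*} [Group G] [Ring A]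
  {ε : A →+* ZMod p} {π : MonoidAlgebra (ZMod p) G →+* A}

namespace IsModel

/-- In the commutative group algebra of `G / γ₂(G)`, the Frobenius power `r ↦ r ^ p ^ n` is induced
by the `p ^ n`-th power map of the group, so its kernel is generated by the elements `t - 1` with
`t ^ p ^ n = 1`. -/
theorem exists_eq_of_pow_mem (h : IsModel ε π) {a b : G} (hab : Subgroup.closure {a, b} = ⊤)
    {d n : ℕ} (ha : orderOf (a : G ⧸ gam 2 G) = d * p ^ n) (hb : b ^ p ^ n ∈ gam 2 G) {y : A}
    (hy : y ^ p ^ n ∈ commIdeal A) :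
    ∃ f₁ f₂, ∃ m ∈ commIdeal A, y = (rho π (a ^ d) - 1) * f₁ + (rho π b - 1) * f₂ + m := by
  obtain ⟨r, rfl⟩ := h.surj y
  rw [← map_pow, h.map_mem_commIdeal_iff, ← ker_mapQuotient_gam_two, RingHom.mem_ker,
    map_pow] at hy
  obtain ⟨q₁, q₂, hq⟩ := exists_eq_of_pow_prime_pow_eq_zero
    (closure_pair_mk_eq_top (gam 2 G) hab) ha
    ((QuotientGroup.eq_one_iff _).2 hb) hy
  obtain ⟨r₁, rfl⟩ := mapQuotient_surjective _ _ q₁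
  obtain ⟨r₂, rfl⟩ := mapQuotient_surjective _ _ q₂
  refine ⟨π r₁, π r₂, π (r - ((of _ _ (a ^ d) - 1) * r₁ + (of _ _ b - 1) * r₂)), ?_, ?_⟩
  · rw [h.map_mem_commIdeal_iff, ← ker_mapQuotient_gam_two, RingHom.mem_ker, map_sub, ← hq,
      sub_eq_zero]
    simp only [map_add, map_mul, map_sub, map_one, mapQuotient_of, QuotientGroup.mk_pow]
  · simp [rho_apply]

theorem rho_sub_one_pow (h : IsModel ε π) (g : G) (n : ℕ) :
    (rho π g - 1) ^ p ^ n = rho π (g ^ p ^ n) - 1 := by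
  have := h.charP
  rw [sub_pow_char_pow_of_commute _ _ (Commute.one_right _), one_pow, map_pow]

theorem exists_rho_sub_one_eq (h : IsModel ε π) (b c : G) (s t : ℕ) {m : A}
    (hm : m ∈ commIdeal A) :
    ∃ (b' : G) (S T : A), ε S = s ∧ ε T = t ∧ rho π b' - 1 = (rho π b - 1) * S +
      (rho π c - 1) * T + (rho π b - 1) * S * ((rho π c - 1) * T) + m := by
  obtain ⟨k, -, hk⟩ := h.exists_rho_eq hm
  have hb := h.rho_sub_one_mem b
  have hc := h.rho_sub_one_mem c
  obtain ⟨S, hS, εS⟩ := exists_one_add_pow_eq hb s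
  obtain ⟨T, hT, εT⟩ := exists_one_add_pow_eq hc t
  rw [add_sub_cancel, ← map_pow] at hS hT
  refine ⟨b ^ s * c ^ t * k, S, T, εS, εT, ?_⟩
  rw [map_mul, map_mul, hS, hT, hk]
  generalize rho π b - 1 = Y at *
  generalize rho π c - 1 = Z at *
  have mem : Y * S + Z * T + Y * S * (Z * T) ∈ RingHom.ker ε :=
    Ideal.add_mem _ (Ideal.add_mem _ (Ideal.mul_mem_right _ _ hb) (Ideal.mul_mem_right _ _ hc))
      (Ideal.mul_mem_left _ _ (Ideal.mul_mem_right _ _ hc))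
  rw [show (1 + Y * S) * (1 + Z * T) = 1 + (Y * S + Z * T + Y * S * (Z * T)) by noncomm_ring,
    h.isSmall.one_add_mul_one_add mem hm]
  abel

theorem exists_eq_rho_sub_one_add (h : IsModel ε π) {b c : G}
    (hc : rho π c - 1 ∈ RingHom.ker ε * RingHom.ker ε) (f₁ f₂ : A) {m : A}
    (hm : m ∈ commIdeal A) :
    ∃ (b' : G) (s : ℕ), ∃ g₁ ∈ RingHom.ker ε, ∃ g₂ ∈ RingHom.ker ε,
      (rho π c - 1) * f₁ + (rho π b - 1) * f₂ + m =
        rho π b' - 1 + ((rho π c - 1) * g₁ + (rho π b - 1) * g₂) ∧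
      rho π b' - 1 - s • (rho π b - 1) ∈ RingHom.ker ε * RingHom.ker ε := by
  obtain ⟨b', S, T, εS, εT, hb'⟩ := h.exists_rho_sub_one_eq b c (ε f₂).val (ε f₁).val hm
  have hb := h.rho_sub_one_mem b
  refine ⟨b', (ε f₂).val, f₁ - T, ?_, f₂ - S - S * ((rho π c - 1) * T), ?_, ?_⟩
  · rw [RingHom.mem_ker, map_sub, εT, ZMod.natCast_zmod_val, sub_self]
  · rw [RingHom.mem_ker, map_sub, map_sub, map_mul, map_mul,
      RingHom.mem_ker.1 (Ideal.mul_le_right hc), εS, ZMod.natCast_zmod_val, sub_self, zero_mul,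
      mul_zero, sub_zero]
  rw [hb']
  generalize rho π b - 1 = Y at *
  generalize rho π c - 1 = Z at *
  constructor
  · noncomm_ring
  have regroup : Y * S + Z * T + Y * S * (Z * T) + m - (ε f₂).val • Y =
      Y * (S - (ε f₂).val) + (Z * T + Y * S * (Z * T) + m) := by
    rw [nsmul_eq_mul, (Nat.cast_commute _ Y).eq, mul_sub]
    abel
  have S_sub_mem : S - (ε f₂).val ∈ RingHom.ker ε := by
    rw [RingHom.mem_ker, map_sub, εS, map_natCast, sub_self]
  have ZT_mem : Z * T ∈ RingHom.ker ε * RingHom.ker ε := Ideal.mul_mem_right _ _ hc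
  rw [regroup]
  exact Ideal.add_mem _ (Ideal.mul_mem_mul hb S_sub_mem) (Ideal.add_mem _ (Ideal.add_mem _
    ZT_mem (Ideal.mul_mem_left _ _ ZT_mem)) (h.isSmall.M_le hm))

/-- Write `y` as `(a - 1) ^ p ^ (m - n) f₁ + (b - 1) f₂` modulo the commutator ideal: after the
scalar parts of `f₁` and `f₂` are absorbed in the lift of `y`, what is left of the sum lies in `D²`
and has Frobenius power `0`. -/
theorem exists_rho_sub_one_pow_eq (h : IsModel ε π) {a b : G}
    (hab : Subgroup.closure {a, b} = ⊤) {m n : ℕ} (hn : n ≠ 0) (hnm : n < m)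
    (ha : orderOf (a : G ⧸ gam 2 G) = p ^ m) (hb : b ^ p ^ n ∈ gam 2 G) {y : A}
    (hy : y ^ p ^ n ∈ commIdeal A) :
    ∃ (b' : G) (s : ℕ), y - (rho π b' - 1) ∈ RingHom.ker ε * RingHom.ker ε ∧
      y ^ p ^ n = (rho π b' - 1) ^ p ^ n ∧
      rho π b' - 1 - s • (rho π b - 1) ∈ RingHom.ker ε * RingHom.ker ε := by
  have := h.charP
  have small := h.isSmall
  have two_le := two_le_prime_pow (p := p) hn
  have pow_m : p ^ (m - n) * p ^ n = p ^ m := by rw [← pow_add, Nat.sub_add_cancel hnm.le]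
  have hYD := h.rho_sub_one_mem b
  have hZD : rho π (a ^ p ^ (m - n)) - 1 ∈ RingHom.ker ε * RingHom.ker ε := by
    rw [← h.rho_sub_one_pow]
    exact pow_mem_sq_of_mem_ideal _ (h.rho_sub_one_mem a)
      (two_le_prime_pow (Nat.sub_ne_zero_of_lt hnm))
  have hYM : (rho π b - 1) ^ p ^ n ∈ commIdeal A := by
    rwa [h.rho_sub_one_pow, h.rho_sub_one_mem_commIdeal_iff]
  have hZM : (rho π (a ^ p ^ (m - n)) - 1) ^ p ^ n ∈ commIdeal A := by
    rw [h.rho_sub_one_pow, h.rho_sub_one_mem_commIdeal_iff, ← pow_mul, pow_m,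
      ← QuotientGroup.eq_one_iff, QuotientGroup.mk_pow, ← ha, pow_orderOf_eq_one]
  obtain ⟨f₁, f₂, μ, hμ, rfl⟩ := h.exists_eq_of_pow_mem hab (ha.trans pow_m.symm) hb hy
  obtain ⟨b', s, g₁, hg₁, g₂, hg₂, decomp, b'_mem⟩ := h.exists_eq_rho_sub_one_add hZD f₁ f₂ hμ
  rw [decomp]
  have hZg : (rho π (a ^ p ^ (m - n)) - 1) * g₁ ∈ RingHom.ker ε * RingHom.ker ε :=
    Ideal.mul_mem_mul (Ideal.mul_le_right hZD) hg₁
  have hYg : (rho π b - 1) * g₂ ∈ RingHom.ker ε * RingHom.ker ε := Ideal.mul_mem_mul hYD hg₂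
  refine ⟨b', s, by simpa using Ideal.add_mem _ hZg hYg, ?_, b'_mem⟩
  generalize rho π (a ^ p ^ (m - n)) - 1 = Z at *
  generalize rho π b - 1 = Y at *
  generalize rho π b' - 1 = Y' at *
  have commute : Commute Y' (Z * g₁ + Y * g₂) := by
    refine Commute.add_right (small.commute_mul_of_mem_sq Y' hZD hg₁) ?_
    rw [← sub_add_cancel Y' (s • Y)]
    refine Commute.add_left (small.commute_of_mem_sq b'_mem hYg)
      ((small.commute_self_mul hYD g₂).smul_left s)
  have pow_eq_zero : (Z * g₁ + Y * g₂) ^ p ^ n = 0 := by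
    rw [small.add_pow_of_sq hZg hYg,
      small.mul_pow_eq_zero two_le (Ideal.mul_le_right hZD) hZM hg₁,
      small.mul_pow_eq_zero two_le hYD hYM hg₂, add_zero]
  rw [add_pow_char_pow_of_commute _ _ commute, pow_eq_zero, add_zero]

end IsModel

end Model

/-! ### Generating pairs of groups -/

section Pairs

theorem closure_pair_le_range_noncommCoprod {Γ : Type*} [Group Γ] {u v : Γ} (huv : Commute u v) :
    ∃ f : Subgroup.zpowers u × Subgroup.zpowers v →* Γ, Subgroup.closure {u, v} ≤ f.range := by
  refine ⟨MonoidHom.noncommCoprod (Subgroup.zpowers u).subtype (Subgroup.zpowers v).subtype ?_, ?_⟩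
  · rintro ⟨_, i, rfl⟩ ⟨_, j, rfl⟩
    exact huv.zpow_zpow i j
  · rw [MonoidHom.noncommCoprod_range, Subgroup.range_subtype, Subgroup.range_subtype,
      Subgroup.closure_le]
    rintro _ (rfl | rfl)
    exacts [Subgroup.mem_sup_left (Subgroup.mem_zpowers _),
      Subgroup.mem_sup_right (Subgroup.mem_zpowers _)]

theorem card_closure_pair_le_of_commute {Γ : Type*} [Group Γ] {u v : Γ} (huv : Commute u v)
    {P Q : ℕ} (hP : P ≠ 0) (hQ : Q ≠ 0) (hu : u ^ P = 1) (hv : v ^ Q = 1) :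
    Nat.card (Subgroup.closure {u, v}) ≤ P * Q := by
  obtain ⟨f, hf⟩ := closure_pair_le_range_noncommCoprod huv
  have : Finite (Subgroup.zpowers u) := (finite_zpowers.2
    (isOfFinOrder_iff_pow_eq_one.2 ⟨P, Nat.pos_of_ne_zero hP, hu⟩)).to_subtype
  have : Finite (Subgroup.zpowers v) := (finite_zpowers.2
    (isOfFinOrder_iff_pow_eq_one.2 ⟨Q, Nat.pos_of_ne_zero hQ, hv⟩)).to_subtype
  have : Finite f.range := Set.finite_range f
  calc Nat.card (Subgroup.closure {u, v})
      ≤ Nat.card f.range := Subgroup.card_le_of_le hf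
    _ ≤ Nat.card (Subgroup.zpowers u × Subgroup.zpowers v) := Finite.card_range_le f
    _ = orderOf u * orderOf v := by rw [Nat.card_prod, Nat.card_zpowers, Nat.card_zpowers]
    _ ≤ P * Q := Nat.mul_le_mul (orderOf_le_of_pow_eq_one (Nat.pos_of_ne_zero hP) hu)
      (orderOf_le_of_pow_eq_one (Nat.pos_of_ne_zero hQ) hv)

theorem card_le_card_mul_card_map_mk {Γ : Type*} [Group Γ] [Finite Γ] (T L : Subgroup Γ)
    [T.Normal] :
    Nat.card L ≤ Nat.card T * Nat.card (L.map (QuotientGroup.mk' T)) := by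
  let f : L →* Γ ⧸ T := (QuotientGroup.mk' T).comp L.subtype
  have card_ker_le : Nat.card f.ker ≤ Nat.card T :=
    Nat.card_le_card_of_injective
      (fun x : f.ker => (⟨x.1.1, (QuotientGroup.eq_one_iff _).1 x.2⟩ : T))
      fun _ _ hxy => Subtype.ext (Subtype.ext (Subtype.mk.inj hxy))
  have range_eq : f.range = L.map (QuotientGroup.mk' T) := by
    rw [MonoidHom.range_comp, Subgroup.range_subtype]
  rw [← range_eq, ← Subgroup.index_ker f, ← Subgroup.card_mul_index f.ker]
  exact Nat.mul_le_mul_right _ card_ker_le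

theorem card_closure_pair_le_of_normal {Γ : Type*} [Group Γ] [Finite Γ] (T : Subgroup Γ)
    [T.Normal] {g₁ g₂ : Γ} {P Q : ℕ} (hP : P ≠ 0) (hQ : Q ≠ 0) (hc : ⁅g₁, g₂⁆ ∈ T)
    (h₁ : g₁ ^ P ∈ T) (h₂ : g₂ ^ Q ∈ T) :
    Nat.card (Subgroup.closure {g₁, g₂}) ≤ Nat.card T * (P * Q) := by
  refine (card_le_card_mul_card_map_mk T _).trans (Nat.mul_le_mul_left _ ?_)
  rw [MonoidHom.map_closure, Set.image_pair]
  refine card_closure_pair_le_of_commute ?_ hP hQ ((QuotientGroup.eq_one_iff _).2 h₁)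
    ((QuotientGroup.eq_one_iff _).2 h₂)
  rw [← commutatorElement_eq_one_iff_commute, ← map_commutatorElement]
  exact (QuotientGroup.eq_one_iff _).2 hc

theorem card_closure_pair_le_of_mem_normalizer {Γ : Type*} [Group Γ] [Finite Γ] (T : Subgroup Γ)
    {g₁ g₂ : Γ} {P Q : ℕ} (hP : P ≠ 0) (hQ : Q ≠ 0)
    (hn₁ : g₁ ∈ Subgroup.normalizer (T : Set Γ)) (hn₂ : g₂ ∈ Subgroup.normalizer (T : Set Γ))
    (hc : ⁅g₁, g₂⁆ ∈ T) (h₁ : g₁ ^ P ∈ T) (h₂ : g₂ ^ Q ∈ T) :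
    Nat.card (Subgroup.closure {g₁, g₂}) ≤ Nat.card T * (P * Q) := by
  let N := Subgroup.normalizer (T : Set Γ)
  have closure_eq : Subgroup.closure {g₁, g₂} =
      (Subgroup.closure {(⟨g₁, hn₁⟩ : N), ⟨g₂, hn₂⟩}).map N.subtype := by
    rw [MonoidHom.map_closure, Set.image_pair]
    rfl
  have card_T : Nat.card (T.subgroupOf N) = Nat.card T :=
    Nat.card_congr (Subgroup.subgroupOfEquivOfLe Subgroup.le_normalizer).toEquiv
  rw [closure_eq, Subgroup.card_map_of_injective N.subtype_injective, ← card_T]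
  exact card_closure_pair_le_of_normal (T.subgroupOf N) hP hQ hc h₁ h₂

theorem nonempty_mulEquiv_of_closure_pair {Γ₁ Γ₂ : Type*} [Group Γ₁] [Group Γ₂] [Finite Γ₁]
    [Finite Γ₂] {x y : Γ₁} {x' y' : Γ₂} (hxy : Subgroup.closure {x, y} = ⊤)
    (hxy' : Subgroup.closure {x', y'} = ⊤)
    (hcard : Nat.card (Subgroup.closure {(x, x'), (y, y')}) ≤ Nat.card Γ₁)
    (hcard' : Nat.card (Subgroup.closure {(x, x'), (y, y')}) ≤ Nat.card Γ₂) :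
    Nonempty (Γ₁ ≃* Γ₂) := by
  let L := Subgroup.closure {(x, x'), (y, y')}
  have bijective_fst : Function.Bijective ((MonoidHom.fst Γ₁ Γ₂).comp L.subtype) := by
    refine Function.Surjective.bijective_of_nat_card_le ?_ hcard
    rw [← MonoidHom.range_eq_top, MonoidHom.range_comp, Subgroup.range_subtype,
      MonoidHom.map_closure, Set.image_pair]
    exact hxy
  have bijective_snd : Function.Bijective ((MonoidHom.snd Γ₁ Γ₂).comp L.subtype) := by
    refine Function.Surjective.bijective_of_nat_card_le ?_ hcard'
    rw [← MonoidHom.range_eq_top, MonoidHom.range_comp, Subgroup.range_subtype,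
      MonoidHom.map_closure, Set.image_pair]
    exact hxy'
  exact ⟨(MulEquiv.ofBijective _ bijective_fst).symm.trans (MulEquiv.ofBijective _ bijective_snd)⟩

end Pairs

section Abelian

variable {p : ℕ} [Fact p.Prime] {Q : Type*} [CommGroup Q] {a b : Q}

theorem card_eq_orderOf_mul_orderOf_mk (hab : Subgroup.closure {a, b} = ⊤) :
    Nat.card Q = orderOf a * orderOf (b : Q ⧸ Subgroup.zpowers a) := by
  have zpowers_eq_top : Subgroup.zpowers (b : Q ⧸ Subgroup.zpowers a) = ⊤ := by
    have mk_a : (a : Q ⧸ Subgroup.zpowers a) = 1 :=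
      (QuotientGroup.eq_one_iff a).2 (Subgroup.mem_zpowers a)
    have := closure_pair_mk_eq_top (Subgroup.zpowers a) hab
    rwa [mk_a, Subgroup.closure_insert_one, ← Subgroup.zpowers_eq_closure] at this
  rw [Subgroup.card_eq_card_quotient_mul_card_subgroup (Subgroup.zpowers a), Nat.card_zpowers,
    mul_comm, ← Nat.card_zpowers (b : Q ⧸ Subgroup.zpowers a), zpowers_eq_top, Subgroup.card_top]

theorem pow_eq_one_of_closure_pair (hab : Subgroup.closure {a, b} = ⊤) {N : ℕ} (ha : a ^ N = 1)
    (hb : b ^ N = 1) (g : Q) : g ^ N = 1 := by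
  suffices Subgroup.closure {a, b} ≤ (powMonoidHom N : Q →* Q).ker from
    this (hab ▸ Subgroup.mem_top g)
  rw [Subgroup.closure_le]
  rintro _ (rfl | rfl)
  exacts [ha, hb]

theorem exists_mul_zpow_pow_eq_one {m n : ℕ} (hnm : n ≤ m) (ha : orderOf a = p ^ m)
    (hb : b ^ p ^ m = 1) (hbn : b ^ p ^ n ∈ Subgroup.zpowers a) :
    ∃ k : ℤ, (b * a ^ k) ^ p ^ n = 1 := by
  obtain ⟨i, hi : a ^ i = b ^ p ^ n⟩ := hbn
  obtain ⟨j, rfl⟩ : ((p ^ n : ℕ) : ℤ) ∣ i := by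
    have zpow_eq_one : a ^ (i * (p ^ (m - n) : ℕ)) = 1 := by
      rw [zpow_mul, hi, zpow_natCast, ← pow_mul, ← pow_add, Nat.add_sub_cancel' hnm, hb]
    rw [← orderOf_dvd_iff_zpow_eq_one, ha, ← Nat.add_sub_cancel' hnm, pow_add,
      Nat.add_sub_cancel_left, Nat.cast_mul] at zpow_eq_one
    exact Int.dvd_of_mul_dvd_mul_right
      (Nat.cast_ne_zero.2 (pow_ne_zero _ (Fact.out : p.Prime).ne_zero)) zpow_eq_one
  refine ⟨-j, ?_⟩
  rw [mul_pow, ← hi, ← zpow_natCast (a ^ (-j)), ← zpow_mul, ← zpow_add, neg_mul, mul_comm,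
    add_neg_cancel, zpow_zero]

theorem exists_complement (hab : Subgroup.closure {a, b} = ⊤) {m : ℕ} (ha : orderOf a = p ^ m)
    (hb : b ^ p ^ m = 1) :
    ∃ (k : ℤ) (n : ℕ), n ≤ m ∧ (b * a ^ k) ^ p ^ n = 1 ∧ Nat.card Q = p ^ (m + n) := by
  have mk_pow : (b : Q ⧸ Subgroup.zpowers a) ^ p ^ m = 1 := by
    rw [← QuotientGroup.mk_pow, hb, QuotientGroup.mk_one]
  obtain ⟨n, hnm, hn⟩ := (Nat.dvd_prime_pow Fact.out).1 (orderOf_dvd_of_pow_eq_one mk_pow)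
  have hbn : b ^ p ^ n ∈ Subgroup.zpowers a := by
    rw [← QuotientGroup.eq_one_iff, QuotientGroup.mk_pow, ← hn, pow_orderOf_eq_one]
  obtain ⟨k, hk⟩ := exists_mul_zpow_pow_eq_one hnm ha hb hbn
  exact ⟨k, n, hnm, hk, by rw [card_eq_orderOf_mul_orderOf_mk hab, ha, hn, pow_add]⟩

end Abelian

/-- Generators `a`, `b` of a `p`-group `G` adapted to a decomposition of its abelianization as
`C_{p ^ m} × C_{p ^ n}` with `n ≤ m`: the first factor is generated by the class of `a`, the second
by the class of `b`. -/
structure AdaptedGenerators (p : ℕ) {G : Type*} [Group G] (a b : G) (m n : ℕ) : Prop where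
  closure_eq_top : Subgroup.closure {a, b} = ⊤
  le : n ≤ m
  orderOf_left : orderOf (a : G ⧸ gam 2 G) = p ^ m
  right_pow : b ^ p ^ n ∈ gam 2 G
  card : Nat.card (G ⧸ gam 2 G) = p ^ (m + n)
  pow_mem : ∀ g : G, g ^ p ^ m ∈ gam 2 G

section Adapted

variable {p : ℕ} [Fact p.Prime] {G : Type*} [Group G] {a b : G}

theorem closure_pair_mul_zpow (k : ℤ) (hab : Subgroup.closure {a, b} = ⊤) :
    Subgroup.closure {a, b * a ^ k} = ⊤ := by
  rw [eq_top_iff, ← hab, Subgroup.closure_le]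
  have ha : a ∈ Subgroup.closure {a, b * a ^ k} := Subgroup.subset_closure (Or.inl rfl)
  have hb : b * a ^ k ∈ Subgroup.closure {a, b * a ^ k} := Subgroup.subset_closure (Or.inr rfl)
  rintro _ (rfl | rfl)
  · exact ha
  · simpa using Subgroup.mul_mem _ hb (Subgroup.inv_mem _ (Subgroup.zpow_mem _ ha k))

theorem exists_adaptedGenerators_of_pow_eq_one (hab : Subgroup.closure {a, b} = ⊤) {m : ℕ}
    (ha : orderOf (a : G ⧸ gam 2 G) = p ^ m) (hb : (b : G ⧸ gam 2 G) ^ p ^ m = 1) :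
    ∃ (b' : G) (n : ℕ), AdaptedGenerators p a b' m n := by
  have hcl := closure_pair_mk_eq_top (gam 2 G) hab
  obtain ⟨k, n, hnm, hk, hcard⟩ := exists_complement hcl ha hb
  refine ⟨b * a ^ k, n, closure_pair_mul_zpow k hab, hnm, ha, (QuotientGroup.eq_one_iff _).1 hk,
    hcard, fun g => (QuotientGroup.eq_one_iff _).1 ?_⟩
  exact pow_eq_one_of_closure_pair hcl (ha ▸ pow_orderOf_eq_one _) hb (g : G ⧸ gam 2 G)

theorem exists_adaptedGenerators (hG : IsPGroup p G) (hab : Subgroup.closure {a, b} = ⊤) :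
    ∃ (a' b' : G) (m n : ℕ), AdaptedGenerators p a' b' m n := by
  have orderOf_eq := IsPGroup.iff_orderOf.1 (hG.to_quotient (gam 2 G))
  obtain ⟨m, hm⟩ := orderOf_eq a
  obtain ⟨l, hl⟩ := orderOf_eq b
  rcases le_total l m with hlm | hlm
  · obtain ⟨b', n, h⟩ := exists_adaptedGenerators_of_pow_eq_one hab hm
      (orderOf_dvd_iff_pow_eq_one.1 (hl ▸ pow_dvd_pow p hlm))
    exact ⟨a, b', m, n, h⟩
  · obtain ⟨a', n, h⟩ := exists_adaptedGenerators_of_pow_eq_one (Set.pair_comm a b ▸ hab) hl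
      (orderOf_dvd_iff_pow_eq_one.1 (hm ▸ pow_dvd_pow p hlm))
    exact ⟨b, a', l, n, h⟩

end Adapted

/-! ### Matching pairs of generators -/

/-- The pairs `(x, y)` and `(x', y')` agree modulo the square of the ideal `D`, and have the same
powers `x ^ P`, `y ^ Q` and the same commutator. -/
structure Matches {A : Type*} [Ring A] (D : Ideal A) (P Q : ℕ) (x y x' y' : A) : Prop where
  left_sub_mem : x - x' ∈ D * D
  right_sub_mem : y - y' ∈ D * D
  left_pow : x ^ P = x' ^ P
  right_pow : y ^ Q = y' ^ Q
  comm : x * y - y * x = x' * y' - y' * x'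

theorem eq_two_and_eq_one_of_pow_lt_three {p n : ℕ} (hp : 2 ≤ p) (hn : n ≠ 0) (h : p ^ n < 3) :
    p = 2 ∧ n = 1 := by
  obtain rfl : p = 2 := le_antisymm (Nat.le_of_lt_succ ((Nat.le_self_pow hn p).trans_lt h)) hp
  refine ⟨rfl, le_antisymm ?_ (Nat.one_le_iff_ne_zero.2 hn)⟩
  exact Nat.le_of_lt_succ ((Nat.pow_lt_pow_iff_right one_lt_two).1 (h.trans_le (by norm_num)))

theorem two_nsmul_mul_eq_zero {A : Type*} [Ring A] [CharP A 2] (t : ℕ) (v : A) :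
    (2 * t) • v = 0 := by
  rw [nsmul_eq_mul, Nat.cast_mul, CharP.cast_eq_zero A 2, zero_mul, zero_mul]

namespace IsModel

variable {p : ℕ} [Fact p.Prime] {G : Type*} [Group G] {A : Type*} [Ring A]
  {ε : A →+* ZMod p} {π : MonoidAlgebra (ZMod p) G →+* A}

section Power

variable {k : ℕ} {x x' : A}

theorem pow_eq_pow_of_three_le (h : IsModel ε π) (hk : 3 ≤ p ^ k)
    (hD : ∀ x ∈ RingHom.ker ε, x ^ p ^ k ∈ commIdeal A) (hx : x ∈ RingHom.ker ε)
    (hxx' : x - x' ∈ RingHom.ker ε * RingHom.ker ε) : x ^ p ^ k = x' ^ p ^ k := by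
  have := h.charP
  have k_ne_zero : k ≠ 0 := by
    rintro rfl
    simp at hk
  have x'_mem := (Submodule.sub_mem_iff_right _ hx).1 (Ideal.mul_le_right hxx')
  rw [← add_sub_cancel x' x, h.isSmall.add_pow_of_mem_sq hk x'_mem hxx',
    h.isSmall.sq_pow_eq_zero k_ne_zero hD hxx', add_zero]

theorem pow_eq_pow_of_M_mul_D_eq_zero (h : IsModel ε π) (hk : k ≠ 0)
    (hD : ∀ x ∈ RingHom.ker ε, x ^ p ^ k ∈ commIdeal A)
    (hMD : ∀ z ∈ commIdeal A * RingHom.ker ε, z = 0)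
    (hxx' : x - x' ∈ RingHom.ker ε * RingHom.ker ε) : x ^ p ^ k = x' ^ p ^ k := by
  have := h.charP
  have commute : Commute x' (x - x') :=
    sub_eq_zero.1 (hMD _ (h.isSmall.comm_mem_M_mul_D x' hxx'))
  rw [← add_sub_cancel x' x, add_pow_char_pow_of_commute _ _ commute,
    h.isSmall.sq_pow_eq_zero hk hD hxx', add_zero]

end Power

theorem rho_mul_sub_one_of_eq (h : IsModel ε π) (g : G) {n : G} {m : A} (hm : m ∈ commIdeal A)
    (hn : rho π n = 1 + m) : rho π (g * n) - 1 = rho π g - 1 + m := by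
  rw [map_mul, hn, mul_add, mul_one, h.mul_eq_self g hm, add_sub_right_comm]

section Exists

variable {x y : A} {m n : ℕ}

theorem exists_matches_of_three_le (h : IsModel ε π) (hxy : Spans (RingHom.ker ε) x y)
    (hD : ∀ x ∈ RingHom.ker ε, x ^ p ^ m ∈ commIdeal A) (hm : 3 ≤ p ^ m) (hn : 3 ≤ p ^ n) {b₀ : G}
    (hb₀ : y - (rho π b₀ - 1) ∈ RingHom.ker ε * RingHom.ker ε)
    (hb₀_pow : y ^ p ^ n = (rho π b₀ - 1) ^ p ^ n) :
    ∃ a' b' : G, Matches (RingHom.ker ε) (p ^ m) (p ^ n) x y (rho π a' - 1) (rho π b' - 1) := by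
  have := h.charP
  have small := h.isSmall
  obtain ⟨a₀, ha₀⟩ := h.exists_rho_sub_mem hxy.left_mem
  obtain ⟨μ, hμ, ν, hν, comm_eq⟩ := exists_comm_add_eq small (hxy.congr ha₀ hb₀)
    (small.comm_sub_comm_mem ha₀ hb₀)
  obtain ⟨k, -, hk⟩ := h.exists_rho_eq hμ
  obtain ⟨l, -, hl⟩ := h.exists_rho_eq hν
  have left_eq := h.rho_mul_sub_one_of_eq a₀ hμ hk
  have right_eq := h.rho_mul_sub_one_of_eq b₀ hν hl
  have left_sub_mem : x - (rho π (a₀ * k) - 1) ∈ RingHom.ker ε * RingHom.ker ε := by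
    rw [left_eq, ← sub_sub]
    exact Ideal.sub_mem _ ha₀ (small.M_le hμ)
  refine ⟨a₀ * k, b₀ * l, left_sub_mem, ?_, ?_, ?_, ?_⟩
  · rw [right_eq, ← sub_sub]
    exact Ideal.sub_mem _ hb₀ (small.M_le hν)
  · exact h.pow_eq_pow_of_three_le hm hD hxy.left_mem left_sub_mem
  · rw [right_eq, small.add_pow_of_mem_sq hn (h.rho_sub_one_mem b₀) (small.M_le hν),
      small.M_pow hν (Nat.le_of_succ_le hn), add_zero, hb₀_pow]
  · rw [left_eq, right_eq, comm_eq, add_sub_cancel]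

theorem exists_matches_of_M_mul_D_eq_zero (h : IsModel ε π) (hx : x ∈ RingHom.ker ε)
    (hD : ∀ x ∈ RingHom.ker ε, x ^ p ^ m ∈ commIdeal A) (hm : m ≠ 0)
    (hMD : ∀ z ∈ commIdeal A * RingHom.ker ε, z = 0) {b₀ : G}
    (hb₀ : y - (rho π b₀ - 1) ∈ RingHom.ker ε * RingHom.ker ε)
    (hb₀_pow : y ^ p ^ n = (rho π b₀ - 1) ^ p ^ n) :
    ∃ a' b' : G, Matches (RingHom.ker ε) (p ^ m) (p ^ n) x y (rho π a' - 1) (rho π b' - 1) := by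
  obtain ⟨a₀, ha₀⟩ := h.exists_rho_sub_mem hx
  exact ⟨a₀, b₀, ha₀, hb₀, h.pow_eq_pow_of_M_mul_D_eq_zero hm hD hMD ha₀, hb₀_pow,
    sub_eq_zero.1 (hMD _ (h.isSmall.comm_sub_comm_mem ha₀ hb₀))⟩

variable {a b : G}

theorem commIdeal_eq_bot_of_mem_gam_two (h : IsModel ε π) (hab : Subgroup.closure {a, b} = ⊤)
    (hb : b ∈ gam 2 G) : commIdeal A = ⊥ := by
  have spans := h.spans_of_closure hab
  have b_mem := (h.rho_sub_one_mem_commIdeal_iff b).2 hb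
  have hMD : ∀ z ∈ commIdeal A * RingHom.ker ε, z = 0 := fun z hz =>
    M_mul_D_eq_zero_of_mem_sq h.isSmall spans (h.isSmall.M_le b_mem) hz
  refine (Submodule.eq_bot_iff _).2 fun z hz => ?_
  obtain ⟨r, hr⟩ := exists_sub_zsmul_comm_mem h.isSmall spans hz
  have := hMD _ hr
  rwa [h.isSmall.D_mul_M spans.left_mem b_mem, hMD _ (Ideal.mul_mem_mul b_mem spans.left_mem),
    sub_zero, smul_zero, sub_zero] at this

theorem exists_matches_of_right_exponent_eq_zero (h : IsModel ε π)
    (hab : AdaptedGenerators p a b m 0) (hx : x ∈ RingHom.ker ε) (hy : y ∈ commIdeal A) :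
    ∃ a' b' : G, Matches (RingHom.ker ε) (p ^ m) (p ^ 0) x y (rho π a' - 1) (rho π b' - 1) := by
  have hD := (h.pow_mem_iff m).1 hab.pow_mem
  have hM : ∀ z ∈ commIdeal A, z = 0 := (Submodule.eq_bot_iff _).1
    (h.commIdeal_eq_bot_of_mem_gam_two hab.closure_eq_top (by simpa using hab.right_pow))
  obtain rfl := hM y hy
  rcases eq_or_ne m 0 with rfl | hm
  · obtain rfl : x = 0 := hM x (by simpa using hD x hx)
    exact ⟨1, 1, by constructor <;> simp⟩
  · exact h.exists_matches_of_M_mul_D_eq_zero hx hD hm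
      (fun z hz => hM z (Ideal.mul_le_left hz)) (b₀ := 1) (by simp) (by simp)

theorem exists_matches_of_exponents_eq (h : IsModel ε π) (hab : AdaptedGenerators p a b n n)
    (hn : n ≠ 0) (hxy : Spans (RingHom.ker ε) x y) :
    ∃ a' b' : G, Matches (RingHom.ker ε) (p ^ n) (p ^ n) x y (rho π a' - 1) (rho π b' - 1) := by
  have hD := (h.pow_mem_iff n).1 hab.pow_mem
  obtain ⟨b₀, hb₀⟩ := h.exists_rho_sub_mem hxy.right_mem
  rcases le_or_gt 3 (p ^ n) with h3 | h3
  · exact h.exists_matches_of_three_le hxy hD h3 h3 hb₀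
      (h.pow_eq_pow_of_three_le h3 hD hxy.right_mem hb₀)
  · obtain ⟨rfl, rfl⟩ := eq_two_and_eq_one_of_pow_lt_three (Fact.out : p.Prime).two_le hn h3
    have hMD : ∀ z ∈ commIdeal A * RingHom.ker ε, z = 0 := fun z hz =>
      M_mul_D_eq_zero_of_sq_mem h.isSmall hxy (by simpa using hD) hz
    exact h.exists_matches_of_M_mul_D_eq_zero hxy.left_mem hD hn hMD hb₀
      (h.pow_eq_pow_of_M_mul_D_eq_zero hn hD hMD hb₀)

end Exists

theorem exists_matches_of_char_two {ε : A →+* ZMod 2} {π : MonoidAlgebra (ZMod 2) G →+* A}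
    {x y : A} {m n : ℕ} {a b b₀ : G} (h : IsModel ε π) (hab : Subgroup.closure {a, b} = ⊤)
    (hx : x ∈ RingHom.ker ε) (hD : ∀ x ∈ RingHom.ker ε, x ^ 2 ^ m ∈ commIdeal A)
    (hm : 3 ≤ 2 ^ m) (hb₀ : y - (rho π b₀ - 1) ∈ RingHom.ker ε * RingHom.ker ε)
    (hb₀_pow : y ^ 2 ^ n = (rho π b₀ - 1) ^ 2 ^ n)
    (hbb₀ : rho π b₀ - 1 - (rho π b - 1) ∈ RingHom.ker ε * RingHom.ker ε) :
    ∃ a' b' : G, Matches (RingHom.ker ε) (2 ^ m) (2 ^ n) x y (rho π a' - 1) (rho π b' - 1) := by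
  have := h.charP
  obtain ⟨a₀, ha₀⟩ := h.exists_rho_sub_mem hx
  obtain ⟨i, μ, hμ, x', hx', sub_mem, comm_eq⟩ := exists_comm_add_eq_of_char_two h.isSmall
    (h.spans_of_closure hab) (h.rho_sub_one_mem a₀) hbb₀ (h.isSmall.comm_sub_comm_mem ha₀ hb₀)
  obtain ⟨k, -, hk⟩ := h.exists_rho_eq hμ
  obtain rfl : x' = rho π (a₀ * a ^ (2 * i) * k) - 1 := by
    rw [map_mul, map_mul, map_pow, hk, eq_sub_iff_add_eq', hx', add_sub_cancel, add_sub_cancel]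
  have left_sub_mem : x - (rho π (a₀ * a ^ (2 * i) * k) - 1) ∈ RingHom.ker ε * RingHom.ker ε :=
    sub_add_sub_cancel x (rho π a₀ - 1) _ ▸ Ideal.add_mem _ ha₀ sub_mem
  exact ⟨_, b₀, left_sub_mem, hb₀, h.pow_eq_pow_of_three_le hm hD hx left_sub_mem, hb₀_pow,
    by rw [comm_eq, add_sub_cancel]⟩

theorem exists_matches_of_lt {x y : A} {m n : ℕ} {a b : G} (h : IsModel ε π)
    (hab : AdaptedGenerators p a b m n) (hn : n ≠ 0) (hnm : n < m)
    (hxy : Spans (RingHom.ker ε) x y) (hy : y ^ p ^ n ∈ commIdeal A) :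
    ∃ a' b' : G, Matches (RingHom.ker ε) (p ^ m) (p ^ n) x y (rho π a' - 1) (rho π b' - 1) := by
  have := h.charP
  have hp := (Fact.out : p.Prime)
  have hD := (h.pow_mem_iff m).1 hab.pow_mem
  have hm : 3 ≤ p ^ m := (Nat.succ_le_succ (two_le_prime_pow hn)).trans
    (Nat.pow_lt_pow_right hp.one_lt hnm)
  obtain ⟨b₀, s, hb₀, hb₀_pow, hs⟩ :=
    h.exists_rho_sub_one_pow_eq hab.closure_eq_top hn hnm hab.orderOf_left hab.right_pow hy
  rcases le_or_gt 3 (p ^ n) with h3 | h3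
  · exact h.exists_matches_of_three_le hxy hD hm h3 hb₀ hb₀_pow
  obtain ⟨rfl, rfl⟩ := eq_two_and_eq_one_of_pow_lt_three hp.two_le hn h3
  rcases Nat.even_or_odd' s with ⟨t, rfl | rfl⟩
  · rw [two_nsmul_mul_eq_zero, sub_zero] at hs
    have y_mem_sq := (Submodule.sub_mem_iff_left _ hs).1 hb₀
    exact h.exists_matches_of_M_mul_D_eq_zero hxy.left_mem hD (Nat.ne_zero_of_lt hnm)
      (fun z hz => M_mul_D_eq_zero_of_mem_sq h.isSmall hxy y_mem_sq hz) hb₀ hb₀_pow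
  · rw [add_smul, two_nsmul_mul_eq_zero, zero_add, one_smul] at hs
    exact h.exists_matches_of_char_two hab.closure_eq_top hxy.left_mem hD hm hb₀ hb₀_pow hs

theorem exists_matches {x y : A} {m n : ℕ} {a b : G} (h : IsModel ε π)
    (hab : AdaptedGenerators p a b m n) (hxy : Spans (RingHom.ker ε) x y)
    (hy : y ^ p ^ n ∈ commIdeal A) :
    ∃ a' b' : G, Matches (RingHom.ker ε) (p ^ m) (p ^ n) x y (rho π a' - 1) (rho π b' - 1) := by
  rcases eq_or_ne n 0 with rfl | hn
  · exact h.exists_matches_of_right_exponent_eq_zero hab hxy.left_mem (by simpa using hy)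
  rcases hab.le.eq_or_lt with rfl | hnm
  · exact h.exists_matches_of_exponents_eq hab hn hxy
  · exact h.exists_matches_of_lt hab hn hnm hxy hy

end IsModel

/-! ### Comparing two groups with a common model -/

section FibreSubgroup

variable {A Γ₁ Γ₂ : Type*} [Ring A] [Group Γ₁] [Group Γ₂]

/-- The pairs of group elements with the same image in `A`, lying in `1 + M`. -/
def fibreSubgroup (φ : Γ₁ →* A) (ψ : Γ₂ →* A) (M : Ideal A) [M.IsTwoSided] :
    Subgroup (Γ₁ × Γ₂) :=
  (φ.comp (MonoidHom.fst Γ₁ Γ₂)).eqLocus (ψ.comp (MonoidHom.snd Γ₁ Γ₂)) ⊓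
    ((Ideal.Quotient.mk M : A →* A ⧸ M).comp (φ.comp (MonoidHom.fst Γ₁ Γ₂))).ker

variable {φ : Γ₁ →* A} {ψ : Γ₂ →* A} {M : Ideal A} [M.IsTwoSided]

theorem mem_fibreSubgroup {t : Γ₁ × Γ₂} :
    t ∈ fibreSubgroup φ ψ M ↔ φ t.1 = ψ t.2 ∧ φ t.1 - 1 ∈ M :=
  and_congr Iff.rfl Ideal.Quotient.eq

theorem card_fibreSubgroup_le [Finite M] (hφ : Function.Injective φ) (hψ : Function.Injective ψ) :
    Nat.card (fibreSubgroup φ ψ M) ≤ Nat.card M := by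
  refine Nat.card_le_card_of_injective
    (fun t : fibreSubgroup φ ψ M => (⟨φ t.1.1 - 1, (mem_fibreSubgroup.1 t.2).2⟩ : M)) ?_
  rintro ⟨t, ht⟩ ⟨t', ht'⟩ htt'
  have left_eq : φ t.1 = φ t'.1 := sub_left_inj.1 (Subtype.mk.inj htt')
  have right_eq : ψ t.2 = ψ t'.2 := by
    rw [← (mem_fibreSubgroup.1 ht).1, left_eq, (mem_fibreSubgroup.1 ht').1]
  exact Subtype.ext (Prod.ext (hφ left_eq) (hψ right_eq))

theorem map_conj_eq_one_add {Γ : Type*} [Group Γ] (φ : Γ →* A) {g u : Γ}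
    (h : φ g * (φ u - 1) = φ u - 1) : φ (g * u * g⁻¹) = 1 + (φ u - 1) * φ g⁻¹ := by
  rw [mul_sub, mul_one, sub_eq_iff_eq_add] at h
  rw [map_mul, map_mul, h, add_mul, ← map_mul, mul_inv_cancel, map_one, add_comm]

theorem mem_normalizer_fibreSubgroup [Finite Γ₁] [Finite Γ₂] {g : Γ₁ × Γ₂}
    (hφ : ∀ m ∈ M, φ g.1 * m = m) (hψ : ∀ m ∈ M, ψ g.2 * m = m)
    (hφψ : ∀ m ∈ M, m * φ g.1⁻¹ = m * ψ g.2⁻¹) :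
    g ∈ Subgroup.normalizer (fibreSubgroup φ ψ M : Set (Γ₁ × Γ₂)) := by
  refine Subgroup.mem_normalizer_fintype fun t ht => ?_
  obtain ⟨eq, mem⟩ := mem_fibreSubgroup.1 ht
  have left_eq : φ (g * t * g⁻¹).1 = 1 + (φ t.1 - 1) * φ g.1⁻¹ :=
    map_conj_eq_one_add φ (hφ _ mem)
  have right_eq : ψ (g * t * g⁻¹).2 = 1 + (ψ t.2 - 1) * ψ g.2⁻¹ :=
    map_conj_eq_one_add ψ (hψ _ (eq ▸ mem))
  refine mem_fibreSubgroup.2 ⟨?_, ?_⟩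
  · rw [left_eq, right_eq, ← eq, hφψ _ mem]
  · rw [left_eq, add_sub_cancel_left]
    exact M.mul_mem_right _ mem

end FibreSubgroup

namespace IsModel

variable {p : ℕ} [Fact p.Prime] {G : Type*} [Group G] {A : Type*} [Ring A]
  {ε : A →+* ZMod p} {π : MonoidAlgebra (ZMod p) G →+* A}

/-- The embedding of `G / γ₂(G)^p γ₄(G)` into the ring of a model. -/
noncomputable def quotientHom (h : IsModel ε π) : G ⧸ kernelSubgroup p G →* A :=
  QuotientGroup.lift (kernelSubgroup p G) (rho π) fun g hg => (h.rho_eq_one_iff g).2 hg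

theorem quotientHom_injective (h : IsModel ε π) : Function.Injective h.quotientHom := by
  intro x y hxy
  obtain ⟨x, rfl⟩ := QuotientGroup.mk_surjective x
  obtain ⟨y, rfl⟩ := QuotientGroup.mk_surjective y
  have rho_eq : rho π x = rho π y := hxy
  rw [QuotientGroup.eq, ← h.rho_eq_one_iff, map_mul, ← rho_eq, rho_inv_mul]

theorem finite [Finite G] (h : IsModel ε π) : Finite A := by
  have : Finite (MonoidAlgebra (ZMod p) G) := Finite.of_equiv (G → ZMod p)
    (MonoidAlgebra.coeffEquiv.trans Finsupp.equivFunOnFinite).symm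
  exact Finite.of_surjective π h.surj

variable {H : Type*} [Group H] {π' : MonoidAlgebra (ZMod p) H →+* A}

theorem mul_rho_inv_eq (h : IsModel ε π) {g : G} {k : H}
    (hgk : rho π' k - rho π g ∈ RingHom.ker ε * RingHom.ker ε) {m : A} (hm : m ∈ commIdeal A) :
    m * rho π g⁻¹ = m * rho π' k⁻¹ := by
  have mul_eq : m * rho π g⁻¹ * rho π' k = m := by
    have := h.isSmall.M_mul_sq (Ideal.mul_mem_right (rho π g⁻¹) _ hm) hgk
    rwa [mul_sub, mul_assoc _ _ (rho π g), rho_inv_mul, mul_one, sub_eq_zero] at this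
  rw [← mul_one (m * _), ← rho_mul_inv π' k, ← mul_assoc, mul_eq]

theorem rho_commutator_eq (h : IsModel ε π) {a b : G} {c d : H}
    (hac : rho π' c - rho π a ∈ RingHom.ker ε * RingHom.ker ε)
    (hbd : rho π' d - rho π b ∈ RingHom.ker ε * RingHom.ker ε)
    (hcomm : rho π' c * rho π' d - rho π' d * rho π' c =
      rho π a * rho π b - rho π b * rho π a) : rho π ⁅a, b⁆ = rho π' ⁅c, d⁆ := by
  have comm_mem := comm_mem_commIdeal (rho π a) (rho π b)
  rw [rho_commutator, rho_commutator, hcomm, map_mul, map_mul, ← mul_assoc, ← mul_assoc,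
    h.mul_rho_inv_eq hac comm_mem, h.mul_rho_inv_eq hbd (Ideal.mul_mem_right _ _ comm_mem)]

theorem mk_mem_normalizer_fibreSubgroup [Finite G] [Finite H] (h : IsModel ε π)
    (h' : IsModel ε π') {g : G} {k : H}
    (hgk : rho π' k - rho π g ∈ RingHom.ker ε * RingHom.ker ε) :
    ((g, k) : (G ⧸ kernelSubgroup p G) × (H ⧸ kernelSubgroup p H)) ∈
      Subgroup.normalizer (fibreSubgroup h.quotientHom h'.quotientHom (commIdeal A) :
        Set ((G ⧸ kernelSubgroup p G) × (H ⧸ kernelSubgroup p H))) :=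
  mem_normalizer_fibreSubgroup (fun _ hm => h.mul_eq_self g hm) (fun _ hm => h'.mul_eq_self k hm)
    fun _ hm => h.mul_rho_inv_eq hgk hm

theorem mk_mem_fibreSubgroup (h : IsModel ε π) (h' : IsModel ε π') {g : G} {k : H}
    (hgk : rho π g = rho π' k) (hg : g ∈ gam 2 G) :
    ((g, k) : (G ⧸ kernelSubgroup p G) × (H ⧸ kernelSubgroup p H)) ∈
      fibreSubgroup h.quotientHom h'.quotientHom (commIdeal A) :=
  mem_fibreSubgroup.2 ⟨hgk, (h.rho_sub_one_mem_commIdeal_iff g).2 hg⟩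

theorem card_closure_pair_mk_le [Finite G] [Finite H] (h : IsModel ε π) (h' : IsModel ε π')
    {a b : G} {c d : H} {P Q : ℕ} (hP : P ≠ 0) (hQ : Q ≠ 0)
    (hac : rho π' c - rho π a ∈ RingHom.ker ε * RingHom.ker ε)
    (hbd : rho π' d - rho π b ∈ RingHom.ker ε * RingHom.ker ε)
    (hcomm : rho π ⁅a, b⁆ = rho π' ⁅c, d⁆) (haP : rho π (a ^ P) = rho π' (c ^ P))
    (hbQ : rho π (b ^ Q) = rho π' (d ^ Q)) (ha : a ^ P ∈ gam 2 G) (hb : b ^ Q ∈ gam 2 G) :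
    Nat.card (Subgroup.closure {((a, c) : (G ⧸ kernelSubgroup p G) × (H ⧸ kernelSubgroup p H)),
      ((b, d) : (G ⧸ kernelSubgroup p G) × (H ⧸ kernelSubgroup p H))}) ≤
        Nat.card (commIdeal A) * (P * Q) := by
  have := h.finite
  have comm_mem : ⁅a, b⁆ ∈ gam 2 G :=
    Subgroup.commutator_mem_commutator (Subgroup.mem_top a) (Subgroup.mem_top b)
  refine (card_closure_pair_le_of_mem_normalizer
    (fibreSubgroup h.quotientHom h'.quotientHom (commIdeal A)) hP hQ
    (h.mk_mem_normalizer_fibreSubgroup h' hac) (h.mk_mem_normalizer_fibreSubgroup h' hbd)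
    (h.mk_mem_fibreSubgroup h' hcomm comm_mem) (h.mk_mem_fibreSubgroup h' haP ha)
    (h.mk_mem_fibreSubgroup h' hbQ hb)).trans (Nat.mul_le_mul_right _ ?_)
  exact card_fibreSubgroup_le h.quotientHom_injective h'.quotientHom_injective

theorem nonempty_mulEquiv_of_matches [Finite G] [Finite H] (h : IsModel ε π) (h' : IsModel ε π')
    {m n : ℕ} {a b : G} {c d : H} (hab : Subgroup.closure {a, b} = ⊤)
    (hcd : Subgroup.closure {c, d} = ⊤) (hG : Nat.card (G ⧸ gam 2 G) = p ^ m * p ^ n)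
    (hH : Nat.card (H ⧸ gam 2 H) = p ^ m * p ^ n) (ha : a ^ p ^ m ∈ gam 2 G)
    (hb : b ^ p ^ n ∈ gam 2 G) (hmatch : Matches (RingHom.ker ε) (p ^ m) (p ^ n)
      (rho π' c - 1) (rho π' d - 1) (rho π a - 1) (rho π b - 1)) :
    Nonempty ((G ⧸ kernelSubgroup p G) ≃* (H ⧸ kernelSubgroup p H)) := by
  obtain ⟨left_sub_mem, right_sub_mem, left_pow, right_pow, comm⟩ := hmatch
  rw [sub_sub_sub_cancel_right] at left_sub_mem right_sub_mem
  rw [h.rho_sub_one_pow, h'.rho_sub_one_pow, sub_left_inj] at left_pow right_pow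
  rw [← mul_sub_mul_eq_sub_one, ← mul_sub_mul_eq_sub_one] at comm
  have p_ne_zero : p ≠ 0 := (Fact.out : p.Prime).ne_zero
  have card_le := h.card_closure_pair_mk_le h' (pow_ne_zero m p_ne_zero) (pow_ne_zero n p_ne_zero)
    left_sub_mem right_sub_mem (h.rho_commutator_eq left_sub_mem right_sub_mem comm)
    left_pow.symm right_pow.symm ha hb
  refine nonempty_mulEquiv_of_closure_pair (closure_pair_mk_eq_top _ hab)
    (closure_pair_mk_eq_top _ hcd) ?_ ?_
  · rwa [h.card_quotient_kernelSubgroup, hG]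
  · rwa [h'.card_quotient_kernelSubgroup, hH]

theorem left_exponent_le (h : IsModel ε π) (h' : IsModel ε π') {a b : G} {c d : H}
    {m n m' n' : ℕ} (hab : AdaptedGenerators p a b m n) (hcd : AdaptedGenerators p c d m' n') :
    m ≤ m' := by
  have pow_mem := (h.pow_mem_iff m').2 ((h'.pow_mem_iff m').1 hcd.pow_mem) a
  rw [← QuotientGroup.eq_one_iff, QuotientGroup.mk_pow, ← orderOf_dvd_iff_pow_eq_one,
    hab.orderOf_left] at pow_mem
  exact (Nat.pow_dvd_pow_iff_le_right (Fact.out : p.Prime).one_lt).1 pow_mem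

theorem right_exponent_eq [Finite G] [Finite H] (h : IsModel ε π) (h' : IsModel ε π') {a b : G}
    {c d : H} {m n n' : ℕ} (hab : AdaptedGenerators p a b m n)
    (hcd : AdaptedGenerators p c d m n') : n = n' := by
  have pow_injective := Nat.pow_right_injective (Fact.out : p.Prime).two_le
  have card_eq : Nat.card (G ⧸ gam 2 G) = Nat.card (H ⧸ gam 2 H) :=
    pow_injective (h.card_quotient_commIdeal.symm.trans h'.card_quotient_commIdeal)
  rw [hab.card, hcd.card] at card_eq
  exact Nat.add_left_cancel (pow_injective card_eq)

theorem nonempty_mulEquiv [Finite G] [Finite H] (h : IsModel ε π) (h' : IsModel ε π')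
    (hG : IsPGroup p G) (hH : IsPGroup p H) (hgen : ∃ a b : G, Subgroup.closure {a, b} = ⊤) :
    Nonempty ((G ⧸ kernelSubgroup p G) ≃* (H ⧸ kernelSubgroup p H)) := by
  obtain ⟨a₀, b₀, hab₀⟩ := hgen
  obtain ⟨c₀, d₀, hcd₀⟩ := h'.exists_spans (h.spans_of_closure hab₀)
  obtain ⟨a, b, m, n, hab⟩ := exists_adaptedGenerators hG hab₀
  obtain ⟨c, d, m', n', hcd⟩ := exists_adaptedGenerators hH (h'.closure_eq_top hH hcd₀)
  obtain rfl : m = m' := le_antisymm (h.left_exponent_le h' hab hcd) (h'.left_exponent_le h hcd hab)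
  obtain rfl : n = n' := h.right_exponent_eq h' hab hcd
  have spans := h'.spans_of_closure hcd.closure_eq_top
  have pow_mem : (rho π' d - 1) ^ p ^ n ∈ commIdeal A := by
    rw [h'.rho_sub_one_pow, h'.rho_sub_one_mem_commIdeal_iff]
    exact hcd.right_pow
  obtain ⟨a', b', hmatch⟩ := h.exists_matches hab spans pow_mem
  refine h.nonempty_mulEquiv_of_matches h' (h.closure_eq_top hG
    (spans.congr hmatch.left_sub_mem hmatch.right_sub_mem)) hcd.closure_eq_top
    (hab.card.trans (pow_add p m n)) (hcd.card.trans (pow_add p m n)) (hab.pow_mem a') ?_ hmatch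
  rwa [← h.rho_sub_one_mem_commIdeal_iff, ← h.rho_sub_one_pow, ← hmatch.right_pow]

end IsModel

section Transfer

variable {p : ℕ} [Fact p.Prime] {G H : Type*} [Group G] [Group H]

theorem aug_map_eq (hG : IsPGroup p G)
    (Ψ : MonoidAlgebra (ZMod p) G →+* MonoidAlgebra (ZMod p) H) (r : MonoidAlgebra (ZMod p) G) :
    aug (ZMod p) H (Ψ r) = aug (ZMod p) G r := by
  induction r using MonoidAlgebra.induction_on with
  | of g =>
    obtain ⟨k, hk⟩ := hG g
    rw [aug_of, ← ZMod.pow_card_pow (n := k) (aug _ _ (Ψ _)), ← map_pow, ← map_pow, ← map_pow, hk,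
      map_one, map_one, map_one]
  | add x y hx hy => rw [map_add, map_add, hx, hy, map_add]
  | smul c x hx =>
    rw [← ZMod.natCast_zmod_val c, Nat.cast_smul_eq_nsmul, map_nsmul, map_nsmul, hx, map_nsmul]

theorem exists_isModel_mk (p : ℕ) [NeZero p] (G : Type*) [Group G] :
    ∃ ε, IsModel (p := p) (G := G) ε
      (Ideal.Quotient.mk (smallIdeal (RingHom.ker (aug (ZMod p) G)))) := by
  have smallIdeal_le_ker : smallIdeal (RingHom.ker (aug (ZMod p) G)) ≤
      RingHom.ker (aug (ZMod p) G : MonoidAlgebra (ZMod p) G →+* ZMod p) :=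
    (smallIdeal_le_commIdeal _).trans ((commIdeal_le_ker_sq _).trans Ideal.mul_le_right)
  exact ⟨Ideal.Quotient.lift _ _ smallIdeal_le_ker, Ideal.Quotient.mk_surjective, Ideal.mk_ker,
    fun r => Ideal.Quotient.lift_mk _ _ _⟩

theorem IsModel.comp_ringEquiv_symm {A : Type*} [Ring A] {ε : A →+* ZMod p}
    {π : MonoidAlgebra (ZMod p) G →+* A} (h : IsModel ε π) (hG : IsPGroup p G)
    (hH : IsPGroup p H) (Ψ : MonoidAlgebra (ZMod p) G ≃+* MonoidAlgebra (ZMod p) H) :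
    IsModel ε (π.comp (Ψ.symm : MonoidAlgebra (ZMod p) H →+* MonoidAlgebra (ZMod p) G)) where
  surj := h.surj.comp Ψ.symm.surjective
  ker := by
    rw [← RingHom.comap_ker, h.ker]
    refine le_antisymm (fun r hr => ?_) (smallIdeal_le_comap _ fun r hr => ?_)
    · have map_mem := smallIdeal_le_comap
        (Ψ : MonoidAlgebra (ZMod p) G →+* MonoidAlgebra (ZMod p) H)
        (D' := RingHom.ker (BaginskiInvariant.aug (ZMod p) H))
        (fun r hr => (aug_map_eq hG _ r).trans hr) hr
      exact Ψ.apply_symm_apply r ▸ Ideal.mem_comap.1 map_mem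
    · exact (aug_map_eq hH _ r).trans hr
  aug r := (h.aug _).trans (aug_map_eq hH _ r)

theorem nonempty_mulEquiv_of_ringEquiv [Finite G] [Finite H] (hG : IsPGroup p G)
    (hH : IsPGroup p H) (hgen : ∃ a b : G, Subgroup.closure {a, b} = ⊤)
    (Ψ : MonoidAlgebra (ZMod p) G ≃+* MonoidAlgebra (ZMod p) H) :
    Nonempty ((G ⧸ kernelSubgroup p G) ≃* (H ⧸ kernelSubgroup p H)) := by
  obtain ⟨ε, h⟩ := exists_isModel_mk p G
  exact h.nonempty_mulEquiv (h.comp_ringEquiv_symm hG hH Ψ) hG hH hgen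

end Transfer

end BaginskiInvariant

theorem mainTheorem3 (p : ℕ) (hp : p.Prime)
    (k : Type*) [Field k] (hk : Nat.card k = p)
    (G : Type*) [Group G] [Finite G] (hG : IsPGroup p G)
    (H : Type*) [Group H] [Finite H] (hH : IsPGroup p H)
    (hgen : ∃ a b : G, Subgroup.closure {a, b} = ⊤)
    (hkGH : Nonempty (MonoidAlgebra k G ≃ₐ[k] MonoidAlgebra k H)) :
    Nonempty ((G ⧸ BaginskiInvariant.kernelSubgroup p G) ≃*
      (H ⧸ BaginskiInvariant.kernelSubgroup p H)) := by
  have : Fact p.Prime := ⟨hp⟩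
  have : Finite k := Nat.finite_of_card_ne_zero (hk ▸ hp.ne_zero)
  let : Fintype k := Fintype.ofFinite k
  let e : ZMod p ≃+* k := ZMod.ringEquivOfPrime k hp (by rw [← Nat.card_eq_fintype_card, hk])
  obtain ⟨Φ⟩ := hkGH
  exact BaginskiInvariant.nonempty_mulEquiv_of_ringEquiv hG hH hgen
    (((MonoidAlgebra.mapRingEquiv G e).trans Φ.toRingEquiv).trans
      (MonoidAlgebra.mapRingEquiv H e.symm))
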